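/- Let $m,n$ be positive integers with $\gcd(m,n)=1$ and let $\mathbb H=\mathbb H_{m/n}=\{(z_1,z_2)\in\mathbb C^2:\ |z_1|^{m/n}<|z_2|<1\}$, with Lebesgue measure $dV$. Let $2\le p<\infty$. Let $A^p$ be the space of holomorphic functions in $L^p(\mathbb H)$, let $G^{2,p}$ be the closure of $A^p$ in the $L^2$ norm, and let $\widetilde{\boldsymbol B}^p$ be the orthogonal projection of $L^2(\mathbb H)$ onto $G^{2,p}$. Write $e_\alpha(z)=z_1^{\alpha_1}z_2^{\alpha_2}$ for $\alpha\in\mathbb Z^2$, and $\mathcal S_p=\{\alpha\in\mathbb Z^2: e_\alpha\in A^p\}$. Then: (a) $A^2$ is closed in $L^2(\mathbb H)$, $\mathcal S_p\subseteq\mathcal S_2$, and the series $$B(z,w)=\sum_{\alpha\in\mathcal S_2}\frac{e_\alpha(z)\overline{e_\alpha(w)}}{\|e_\alpha\|_2^2},\qquad \widetilde B^p(z,w)=\sum_{\alpha\in\mathcal S_p}\frac{e_\alpha(z)\overline{e_\alpha(w)}}{\|e_\alpha\|_2^2}$$ converge absolutely at all $z,w\in\mathbb H$. $B$ is the Bergman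 kernel, i.e. the kernel of the orthogonal projection of $L^2(\mathbb H)$ onto $A^2$, and the subseries $\widetilde B^p$ is the kernel of $\widetilde{\boldsymbol B}^p$. The latter means: for every $f\in L^2(\mathbb H)$ the integral $\int_{\mathbb H}\widetilde B^p(z,w)f(w)\,dV(w)$ converges absolutely at every $z\in\mathbb H$, is a holomorphic function of $z$, and equals $\widetilde{\boldsymbol B}^pf$ almost everywhere; likewise for $B$. (b) The operator $|\widetilde{\boldsymbol B}^p|f(z)=\int_{\mathbb H}|\widetilde B^p(z,w)|\,f(w)\,dV(w)$ is bounded on $L^p(\mathbb H)$: there is a constant $C$ such that, for every $f\in L^p(\mathbb H)$, the integral converges absolutely at every $z\in\mathbb H$ and $\||\widetilde{\boldsymbol B}^p|f\|_p\le C\|f\|_p$. Also $\widetilde{\boldsymbol B}^p$ maps $L^p(\mathbb H)$ boundedly into $A^p$. (c) $\widetilde{\boldsymbol B}^ph=h$ for every $h\in A^p$. (d) For every $g\in L^p(\mathbb H)$, $\widetilde{\boldsymbol B}^pg$ is the unique element of $A^p$ nearest to $g$ in the $L^2$ norm. -/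

import Mathlib

open MeasureTheory
open scoped ENNReal NNReal ComplexConjugate

noncomputable section

namespace GenHartogs

/-- The power-generalized Hartogs triangle of exponent `γ`. -/
def domain (γ : ℝ) : Set (ℂ × ℂ) :=
  {z | ‖z.1‖ ^ γ < ‖z.2‖ ∧ ‖z.2‖ < 1}

/-- Lebesgue measure `dV` restricted to the domain. -/
def vol (γ : ℝ) : Measure (ℂ × ℂ) := volume.restrict (domain γ)

/-- `f` belongs to the Bergman space `A^p`: it is holomorphic on the domain and lies in `L^p`. -/
def MemBergman (γ : ℝ) (p : ℝ≥0∞) (f : ℂ × ℂ → ℂ) : Prop :=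
  DifferentiableOn ℂ f (domain γ) ∧ MemLp f p (vol γ)

/-- The space `L^2` of the domain, as a Hilbert space. -/
abbrev L2 (γ : ℝ) : Type := Lp ℂ 2 (vol γ)

/-- `A^p ∩ L^2` as a subspace of `L^2`; for `p ≥ 2` this is `A^p`, the domain being bounded. -/
def bergmanSubspace (γ : ℝ) (p : ℝ≥0∞) : Submodule ℂ (L2 γ) where
  carrier := {F | ∃ f : ℂ × ℂ → ℂ, MemBergman γ p f ∧ F =ᵐ[vol γ] f}
  zero_mem' := ⟨0, ⟨differentiableOn_const 0, MemLp.zero⟩, Lp.coeFn_zero _ _ _⟩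
  add_mem' := by
    rintro F G ⟨f, hf, hF⟩ ⟨g, hg, hG⟩
    exact ⟨f + g, ⟨hf.1.add hg.1, hf.2.add hg.2⟩, (Lp.coeFn_add F G).trans (hF.add hG)⟩
  smul_mem' := by
    rintro c F ⟨f, hf, hF⟩
    exact ⟨c • f, ⟨hf.1.const_smul c, hf.2.const_smul c⟩,
      (Lp.coeFn_smul c F).trans (hF.const_smul c)⟩

/-- `G^{2,p}`: the closure of `A^p` in the `L^2` norm. -/
def closedBergmanSubspace (γ : ℝ) (p : ℝ≥0∞) : Submodule ℂ (L2 γ) :=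
  (bergmanSubspace γ p).topologicalClosure

instance (γ : ℝ) (p : ℝ≥0∞) : CompleteSpace (closedBergmanSubspace γ p) :=
  inferInstanceAs (CompleteSpace (bergmanSubspace γ p).topologicalClosure)

/-- The `L^p` sub-Bergman projection: the orthogonal projection of `L^2` onto `G^{2,p}`.
For `p = 2` it is the Bergman projection. -/
def subBergmanProjection (γ : ℝ) (p : ℝ≥0∞) : L2 γ →L[ℂ] L2 γ :=
  (closedBergmanSubspace γ p).starProjection

/-- The Laurent monomial `e_α(z) = z₁^{α₁} z₂^{α₂}`. -/
def monomial (α : ℤ × ℤ) (z : ℂ × ℂ) : ℂ := z.1 ^ α.1 * z.2 ^ α.2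

/-- The `L^p`-allowable multi-indices: those `α ∈ ℤ²` with `e_α ∈ A^p`. -/
def allowable (γ : ℝ) (p : ℝ≥0∞) : Set (ℤ × ℤ) := {α | MemBergman γ p (monomial α)}

/-- The term `e_α(z) conj(e_α(w)) / ‖e_α‖₂²` of the Bergman kernel series. -/
def kernelTerm (γ : ℝ) (z w : ℂ × ℂ) (α : ℤ × ℤ) : ℂ :=
  monomial α z * conj (monomial α w) / ((∫ v in domain γ, ‖monomial α v‖ ^ 2 : ℝ) : ℂ)

/-- The sum of the Bergman kernel series over the `L^p`-allowable multi-indices. -/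
def subBergmanKernel (γ : ℝ) (p : ℝ≥0∞) (z w : ℂ × ℂ) : ℂ :=
  ∑' α : allowable γ p, kernelTerm γ z w α

/-- The integral operator with kernel `K`. -/
def integralOp (γ : ℝ) (K : ℂ × ℂ → ℂ × ℂ → ℂ) (f : ℂ × ℂ → ℂ) (z : ℂ × ℂ) : ℂ :=
  ∫ w in domain γ, K z w * f w

/-- The kernel `|K|` of the absolute-value operator. -/
def absKernel (K : ℂ × ℂ → ℂ × ℂ → ℂ) (z w : ℂ × ℂ) : ℂ := ((‖K z w‖ : ℝ) : ℂ)

/-- `K` represents the operator `P` on `L^2`: for every `f ∈ L^2` the integral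
`∫ K(z,w) f(w) dV(w)` converges absolutely at every point `z` of the domain, and it is a
holomorphic function of `z` which is equal to `P f` almost everywhere. -/
def IsRepresentingKernel (γ : ℝ) (K : ℂ × ℂ → ℂ × ℂ → ℂ) (P : L2 γ →L[ℂ] L2 γ) : Prop :=
  ∀ (f : ℂ × ℂ → ℂ) (hf : MemLp f 2 (vol γ)),
    (∀ z ∈ domain γ, IntegrableOn (fun w => K z w * f w) (domain γ)) ∧
    DifferentiableOn ℂ (integralOp γ K f) (domain γ) ∧
    P (hf.toLp f) =ᵐ[vol γ] integralOp γ K f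

/-- The integral operator with kernel `K` is defined and bounded on `L^p`. -/
def IsBoundedOnLp (γ : ℝ) (p : ℝ≥0∞) (K : ℂ × ℂ → ℂ × ℂ → ℂ) : Prop :=
  ∃ C : ℝ≥0, ∀ f : ℂ × ℂ → ℂ, MemLp f p (vol γ) →
    (∀ z ∈ domain γ, IntegrableOn (fun w => K z w * f w) (domain γ)) ∧
    MemLp (integralOp γ K f) p (vol γ) ∧
    eLpNorm (integralOp γ K f) p (vol γ) ≤ C * eLpNorm f p (vol γ)

end GenHartogs

end

/-!
Integrating over the fibres `‖z₁‖ ^ γ < ‖z₂‖` shows that `e_α` lies in `A^p` exactly when `α₁ ≥ 0`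
and `n α₁ + m α₂ > -2 (m + n) / p`. Torus averages isolate the terms of a Laurent expansion, so the
monomials `e_α` with `α` in this set span `A^p` and are orthogonal in `L²`; the subseries `K` of the
Bergman kernel over it therefore reproduces `A^p` and represents the projection onto its closure.

For the boundedness on `L^p`, put `ζ = z w̄` coordinatewise and split the series along the residues
of `α₁` modulo `m`. Each piece is a product of one-variable series, whence
`‖K(z, w)‖ ≤ C ‖ζ₂‖ ^ (-c) ‖1 - ζ₁ ^ m / ζ₂ ^ n‖ ^ (-2) ‖1 - ζ₂‖ ^ (-2)`. Since `n α₁ + m α₂` is an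
integer, the strict inequality in the description of the exponents leaves room for
`c p < 2 + 2 / γ`, which makes Schur's test succeed with weights singular at the boundary and at the
origin.
-/

noncomputable section

namespace GenHartogs

open Set Real Metric

/-! ### Integrals over discs -/

theorem lintegral_ball_eq_polar (ρ : ℝ) {f : ℂ → ℝ≥0∞} (hf : Measurable f) :
    ∫⁻ z in ball (0 : ℂ) ρ, f z =
      ∫⁻ r in Ioo 0 ρ, ENNReal.ofReal r * ∫⁻ θ in Ioo (-π) π, f (circleMap 0 r θ) := by
  have hsymm (q : ℝ × ℝ) : Complex.polarCoord.symm q = circleMap 0 q.1 q.2 := by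
    simp [circleMap, Complex.exp_mul_I]
  have hmeas : Measurable fun q : ℝ × ℝ => circleMap 0 q.1 q.2 := by
    unfold circleMap
    fun_prop
  rw [← lintegral_indicator isOpen_ball.measurableSet, ← Complex.lintegral_comp_polarCoord_symm]
  simp_rw [hsymm, smul_eq_mul]
  rw [show polarCoord.target = Ioi (0 : ℝ) ×ˢ Ioo (-π) π from rfl, Measure.volume_eq_prod,
    setLIntegral_prod _ (by fun_prop (disch := exact isOpen_ball.measurableSet)),
    show Ioo 0 ρ = Iio ρ ∩ Ioi 0 from Iio_inter_Ioi.symm,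
    ← setLIntegral_indicator measurableSet_Iio]
  refine setLIntegral_congr_fun measurableSet_Ioi fun r hr => ?_
  have habs : |r| = r := abs_of_pos hr
  by_cases hrρ : r < ρ
  · simp only [indicator, mem_ball_zero_iff, norm_circleMap_zero, habs, hrρ, if_true, mem_Iio]
    exact lintegral_const_mul _ (by fun_prop)
  · simp [indicator, habs, hrρ]

theorem circleAverage_inv_normSq_one_sub {a : ℂ} {r : ℝ} {m : ℕ} (hm : m ≠ 0)
    (h : ‖a‖ * |r| ^ m < 1) :
    circleAverage (fun ζ => (‖1 - a * ζ ^ m‖ ^ 2)⁻¹) 0 r = (1 - (‖a‖ * |r| ^ m) ^ 2)⁻¹ := by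
  set F : ℂ → ℂ := fun ζ => herglotzRieszKernel 0 (a * ζ ^ m) 1 with hF
  have hdiff : DifferentiableOn ℂ F (closedBall 0 |r|) := by
    intro ζ hζ
    have hlt : ‖a * ζ ^ m‖ < 1 := by
      rw [norm_mul, norm_pow]
      exact lt_of_le_of_lt (by gcongr; simpa using hζ) h
    have hne : 1 - 0 - (a * ζ ^ m - 0) ≠ 0 := by
      simpa [sub_eq_zero] using fun h1 : 1 = a * ζ ^ m => by simp [← h1] at hlt
    refine DifferentiableAt.differentiableWithinAt ?_
    exact DifferentiableAt.div (by fun_prop) (by fun_prop) hne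
  have hmean : circleAverage F 0 r = 1 := by
    rw [(hdiff.mono closure_ball_subset_closedBall).diffContOnCl.circleAverage]
    simp [hF, hm, herglotzRieszKernel_def]
  have hre : circleAverage (Complex.reCLM ∘ F) 0 r = 1 := by
    rw [Complex.reCLM.circleAverage_comp_comm
      (hdiff.continuousOn.mono sphere_subset_closedBall).circleIntegrable', hmean]
    rfl
  have hpoisson : circleAverage (Complex.reCLM ∘ F) 0 r =
      circleAverage (fun ζ => (1 - (‖a‖ * |r| ^ m) ^ 2) • (‖1 - a * ζ ^ m‖ ^ 2)⁻¹) 0 r := by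
    refine circleAverage_congr_sphere fun ζ hζ => ?_
    rw [mem_sphere_zero_iff_norm] at hζ
    change (Complex.re ∘ herglotzRieszKernel 0 (a * ζ ^ m)) 1 = _
    rw [← poissonKernel_eq_re_herglotzRieszKernel, poissonKernel_def]
    simp [hζ, div_eq_mul_inv]
  have hne : 1 - (‖a‖ * |r| ^ m) ^ 2 ≠ 0 := by
    have := pow_lt_one₀ (by positivity) h two_ne_zero
    linarith
  rw [hpoisson, circleAverage_fun_smul, smul_eq_mul] at hre
  exact eq_inv_of_mul_eq_one_right hre

theorem lintegral_Ioo_circleMap {f : ℂ → ℝ} {r : ℝ} (hf : ContinuousOn f (sphere 0 |r|))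
    (hf0 : ∀ ζ, 0 ≤ f ζ) :
    ∫⁻ θ in Ioo (-π) π, ENNReal.ofReal (f (circleMap 0 r θ)) =
      ENNReal.ofReal (2 * π * circleAverage f 0 r) := by
  have hint : ∫ θ in Ioc (-π) π, f (circleMap 0 r θ) = 2 * π * circleAverage f 0 r := by
    have hshift := intervalIntegral.integral_comp_add_right (a := 0) (b := 2 * π)
      (fun θ => f (circleMap 0 r θ)) (-π)
    rw [circleAverage_eq_integral_add (-π), hshift, smul_eq_mul,
      mul_inv_cancel_left₀ two_pi_pos.ne', ← intervalIntegral.integral_of_le (by linarith [pi_pos])]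
    congr 1 <;> ring
  rw [restrict_Ioo_eq_restrict_Ioc, ← hint, ofReal_integral_eq_lintegral_ofReal]
  · have hcont : Continuous fun θ => f (circleMap 0 r θ) :=
      hf.comp_continuous (continuous_circleMap _ _) (circleMap_mem_sphere' _ _)
    exact hcont.integrableOn_Icc.mono_set Ioc_subset_Icc_self
  · exact Filter.Eventually.of_forall fun θ => hf0 _

theorem lintegral_ball_norm (ρ : ℝ) {φ : ℝ → ℝ≥0∞} (hφ : Measurable φ) :
    ∫⁻ z in ball (0 : ℂ) ρ, φ ‖z‖ =
      ENNReal.ofReal (2 * π) * ∫⁻ r in Ioo 0 ρ, ENNReal.ofReal r * φ r := by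
  rw [lintegral_ball_eq_polar ρ (f := fun z => φ ‖z‖) (by fun_prop),
    ← lintegral_const_mul _ (by fun_prop)]
  refine setLIntegral_congr_fun measurableSet_Ioo fun r hr => ?_
  simp only [norm_circleMap_zero, abs_of_pos hr.1, setLIntegral_const, Real.volume_Ioo]
  rw [show π - -π = 2 * π by ring]
  ring

theorem lintegral_ball_norm_rpow (a ρ : ℝ) :
    ∫⁻ z in ball (0 : ℂ) ρ, ENNReal.ofReal (‖z‖ ^ a) =
      ENNReal.ofReal (2 * π) * ∫⁻ r in Ioo 0 ρ, ENNReal.ofReal (r ^ (a + 1)) := by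
  rw [lintegral_ball_norm ρ (φ := fun r => ENNReal.ofReal (r ^ a)) (by fun_prop)]
  congr 1
  refine setLIntegral_congr_fun measurableSet_Ioo fun r hr => ?_
  rw [← ENNReal.ofReal_mul hr.1.le, Real.rpow_add_one hr.1.ne', mul_comm]

theorem lintegral_Ioo_rpow {s t : ℝ} (hs : -1 < s) (ht : 0 ≤ t) :
    ∫⁻ x in Ioo 0 t, ENNReal.ofReal (x ^ s) = ENNReal.ofReal (t ^ (s + 1) / (s + 1)) := by
  have hint : ∫ x in (0 : ℝ)..t, x ^ s = t ^ (s + 1) / (s + 1) := by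
    rw [integral_rpow (Or.inl hs), Real.zero_rpow (by linarith), sub_zero]
  rw [← hint, intervalIntegral.integral_of_le ht, ofReal_integral_eq_lintegral_ofReal,
    restrict_Ioo_eq_restrict_Ioc]
  · exact (intervalIntegrable_iff_integrableOn_Ioc_of_le ht).mp
      (intervalIntegral.intervalIntegrable_rpow' hs)
  · filter_upwards [ae_restrict_mem measurableSet_Ioc] with x hx
    exact Real.rpow_nonneg hx.1.le _

theorem lintegral_Ioo_rpow_eq_top {s t : ℝ} (hs : s ≤ -1) (ht : 0 < t) :
    ∫⁻ x in Ioo 0 t, ENNReal.ofReal (x ^ s) = ∞ := by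
  by_contra hne
  have hint : IntegrableOn (fun x : ℝ => x ^ s) (Ioo 0 t) := by
    refine ⟨(by fun_prop : Measurable fun x : ℝ => x ^ s).aestronglyMeasurable, ?_⟩
    rw [hasFiniteIntegral_iff_ofReal]
    · exact lt_top_iff_ne_top.mpr hne
    · filter_upwards [ae_restrict_mem measurableSet_Ioo] with x hx
      exact Real.rpow_nonneg hx.1.le _
  rw [intervalIntegral.integrableOn_Ioo_rpow_iff ht] at hint
  linarith

theorem lintegral_Ioi_rpow {s t : ℝ} (hs : s < -1) (ht : 0 < t) :
    ∫⁻ x in Ioi t, ENNReal.ofReal (x ^ s) = ENNReal.ofReal (-t ^ (s + 1) / (s + 1)) := by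
  rw [← integral_Ioi_rpow_of_lt hs ht, ofReal_integral_eq_lintegral_ofReal]
  · exact integrableOn_Ioi_rpow_of_lt hs ht
  · filter_upwards [ae_restrict_mem measurableSet_Ioi] with x hx
    exact Real.rpow_nonneg (ht.trans hx).le _

theorem lintegral_unitBall_norm_rpow {a : ℝ} (ha : -2 < a) :
    ∫⁻ z in ball (0 : ℂ) 1, ENNReal.ofReal (‖z‖ ^ a) = ENNReal.ofReal (2 * π / (a + 2)) := by
  rw [lintegral_ball_norm_rpow, lintegral_Ioo_rpow (by linarith) zero_le_one,
    ← ENNReal.ofReal_mul two_pi_pos.le, Real.one_rpow, mul_one_div, add_assoc, one_add_one_eq_two]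

theorem lintegral_unitBall_norm_rpow_eq_top {a : ℝ} (ha : a ≤ -2) :
    ∫⁻ z in ball (0 : ℂ) 1, ENNReal.ofReal (‖z‖ ^ a) = ∞ := by
  rw [lintegral_ball_norm_rpow, lintegral_Ioo_rpow_eq_top (by linarith) one_pos]
  exact ENNReal.mul_top (by simpa using pi_pos)

theorem lintegral_unitBall_norm_rpow_ne_zero (a : ℝ) :
    ∫⁻ z in ball (0 : ℂ) 1, ENNReal.ofReal (‖z‖ ^ a) ≠ 0 := by
  rcases lt_or_ge (-2) a with ha | ha
  · rw [lintegral_unitBall_norm_rpow ha]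
    have : 0 < 2 * π / (a + 2) := div_pos two_pi_pos (by linarith)
    simpa using this
  · simp [lintegral_unitBall_norm_rpow_eq_top ha]

theorem lintegral_rpow_neg_mul_inv_max {ε τ : ℝ} (hε0 : 0 < ε) (hε1 : ε < 1) (hτ : 0 < τ) :
    ∫⁻ s in Ioi (0 : ℝ), ENNReal.ofReal (s ^ (-ε) * (max s τ)⁻¹) =
      ENNReal.ofReal (((1 - ε)⁻¹ + ε⁻¹) * τ ^ (-ε)) := by
  have hε' : 0 < 1 - ε := by linarith
  have hleft : ∫⁻ s in Ioo 0 τ, ENNReal.ofReal (s ^ (-ε) * (max s τ)⁻¹) =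
      ENNReal.ofReal ((1 - ε)⁻¹ * τ ^ (-ε)) := by
    rw [setLIntegral_congr_fun (g := fun s => ENNReal.ofReal τ⁻¹ * ENNReal.ofReal (s ^ (-ε)))
        measurableSet_Ioo, lintegral_const_mul _ (by fun_prop),
      lintegral_Ioo_rpow (by linarith) hτ.le, ← ENNReal.ofReal_mul (by positivity),
      Real.rpow_add_one hτ.ne', neg_add_eq_sub]
    · congr 1
      field_simp
    · intro s hs
      simp only [max_eq_right hs.2.le]
      rw [mul_comm, ENNReal.ofReal_mul (by positivity)]
  have hright : ∫⁻ s in Ici τ, ENNReal.ofReal (s ^ (-ε) * (max s τ)⁻¹) =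
      ENNReal.ofReal (ε⁻¹ * τ ^ (-ε)) := by
    rw [setLIntegral_congr_fun (g := fun s => ENNReal.ofReal (s ^ (-ε - 1))) measurableSet_Ici,
      ← restrict_Ioi_eq_restrict_Ici, lintegral_Ioi_rpow (by linarith) hτ, sub_add_cancel,
      neg_div_neg_eq, div_eq_inv_mul]
    intro s hs
    simp only [max_eq_left hs.out, Real.rpow_sub_one (hτ.trans_le hs).ne', div_eq_mul_inv]
  rw [← Ioo_union_Ici_eq_Ioi hτ, lintegral_union measurableSet_Ici
      (disjoint_left.mpr fun s hs hs' => hs.2.not_ge hs'), hleft, hright,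
    ← ENNReal.ofReal_add (by positivity) (by positivity), add_mul]

theorem lintegral_Ioo_one_sub (f : ℝ → ℝ≥0∞) :
    ∫⁻ x in Ioo (0 : ℝ) 1, f (1 - x) = ∫⁻ x in Ioo (0 : ℝ) 1, f x := by
  have := (Measure.measurePreserving_sub_left volume (1 : ℝ)).setLIntegral_comp_preimage_emb
    (MeasurableEquiv.subLeft (1 : ℝ)).measurableEmbedding f (Ioo 0 1)
  simpa using this

theorem lintegral_one_sub_rpow_neg_mul_inv_le {ε R : ℝ} (hε0 : 0 < ε) (hε1 : ε < 1) (hR0 : 0 ≤ R)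
    (hR1 : R < 1) :
    ∫⁻ r in Ioo (0 : ℝ) 1, ENNReal.ofReal ((1 - r) ^ (-ε) * (1 - r * R)⁻¹) ≤
      ENNReal.ofReal (((1 - ε)⁻¹ + ε⁻¹) * (1 - R) ^ (-ε)) := by
  have hτ : 0 < 1 - R := by linarith
  rw [← lintegral_rpow_neg_mul_inv_max hε0 hε1 hτ, ← lintegral_Ioo_one_sub]
  refine (setLIntegral_mono' measurableSet_Ioo fun s hs => ENNReal.ofReal_le_ofReal ?_).trans
    (lintegral_mono_set Ioo_subset_Ioi_self)
  have hmax : max s (1 - R) ≤ 1 - (1 - s) * R := max_le (by nlinarith [hs.2]) (by nlinarith [hs.1])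
  have : 0 < max s (1 - R) := lt_max_of_lt_right hτ
  have := Real.rpow_nonneg hs.1.le (-ε)
  rw [sub_sub_cancel]
  gcongr

theorem rpow_mul_one_sub_rpow_neg_mul_le {s ε r u : ℝ} (hε1 : ε < 1) (hr0 : 0 < r)
    (hr1 : r < 1) (hu0 : 0 ≤ u) (hu : u ≤ (1 - r)⁻¹) :
    r ^ s * (1 - r) ^ (-ε) * u ≤ 4 * r ^ s + 2 ^ |s| * ((1 - r) ^ (-ε) * u) := by
  have h1r : 0 < 1 - r := by linarith
  rcases le_total r (1 / 2) with h | h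
  · have hinv : (1 - r)⁻¹ ≤ 2 := inv_le_of_inv_le₀ two_pos (by linarith)
    have hpow : (1 - r) ^ (-ε) ≤ 2 :=
      calc (1 - r) ^ (-ε) ≤ (1 - r) ^ (-1 : ℝ) :=
            Real.rpow_le_rpow_of_exponent_ge h1r (by linarith) (by linarith)
        _ ≤ 2 := by rwa [Real.rpow_neg_one]
    calc r ^ s * (1 - r) ^ (-ε) * u ≤ r ^ s * 2 * 2 := by
          gcongr
          exact hu.trans hinv
      _ = 4 * r ^ s := by ring
      _ ≤ _ := le_add_of_nonneg_right (by positivity)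
  · have hpow : r ^ s ≤ 2 ^ |s| :=
      calc r ^ s ≤ r ^ (-|s|) := Real.rpow_le_rpow_of_exponent_ge hr0 hr1.le (neg_abs_le _)
        _ ≤ (1 / 2 : ℝ) ^ (-|s|) :=
            Real.rpow_le_rpow_of_nonpos (by norm_num) h (neg_nonpos.mpr (abs_nonneg _))
        _ = 2 ^ |s| := by rw [one_div, Real.inv_rpow two_pos.le, Real.rpow_neg two_pos.le, inv_inv]
    calc r ^ s * (1 - r) ^ (-ε) * u ≤ 2 ^ |s| * (1 - r) ^ (-ε) * u := by gcongr
      _ = 2 ^ |s| * ((1 - r) ^ (-ε) * u) := mul_assoc _ _ _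
      _ ≤ _ := le_add_of_nonneg_left (by positivity)

theorem exists_lintegral_rpow_mul_one_sub_rpow_neg_mul_inv_le {δ ε : ℝ} (hδ : 0 < δ)
    (hε0 : 0 < ε) (hε1 : ε < 1) :
    ∃ C : ℝ≥0, ∀ R : ℝ, 0 ≤ R → R < 1 →
      ∫⁻ r in Ioo (0 : ℝ) 1, ENNReal.ofReal (r ^ (δ - 1) * (1 - r) ^ (-ε) * (1 - r * R)⁻¹) ≤
        C * ENNReal.ofReal ((1 - R) ^ (-ε)) := by
  set M : ℝ := 2 ^ |δ - 1|
  set N : ℝ := (1 - ε)⁻¹ + ε⁻¹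
  have hN0 : 0 ≤ N := add_nonneg (inv_nonneg.mpr (by linarith)) (inv_nonneg.mpr hε0.le)
  refine ⟨(4 * (1 / δ) + M * N).toNNReal, fun R hR0 hR1 => ?_⟩
  have hone : 1 ≤ (1 - R) ^ (-ε) :=
    Real.one_le_rpow_of_pos_of_le_one_of_nonpos (by linarith) (by linarith) (by linarith)
  calc ∫⁻ r in Ioo (0 : ℝ) 1, ENNReal.ofReal (r ^ (δ - 1) * (1 - r) ^ (-ε) * (1 - r * R)⁻¹)
      ≤ ∫⁻ r in Ioo (0 : ℝ) 1, (ENNReal.ofReal 4 * ENNReal.ofReal (r ^ (δ - 1)) +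
          ENNReal.ofReal M * ENNReal.ofReal ((1 - r) ^ (-ε) * (1 - r * R)⁻¹)) := by
        refine setLIntegral_mono' measurableSet_Ioo fun r hr => ?_
        have hrR : 1 - r ≤ 1 - r * R := by nlinarith [hr.1]
        have hr0 : 0 < r := hr.1
        have hr1 : 0 < 1 - r := by linarith [hr.2]
        have hu0 : 0 ≤ (1 - r * R)⁻¹ := inv_nonneg.mpr (hr1.le.trans hrR)
        rw [← ENNReal.ofReal_mul zero_le_four, ← ENNReal.ofReal_mul (by positivity),
          ← ENNReal.ofReal_add (by positivity) (by positivity)]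
        exact ENNReal.ofReal_le_ofReal (rpow_mul_one_sub_rpow_neg_mul_le hε1 hr0 hr.2 hu0
          (inv_anti₀ hr1 hrR))
    _ = ENNReal.ofReal 4 * ENNReal.ofReal (1 / δ) + ENNReal.ofReal M *
          ∫⁻ r in Ioo (0 : ℝ) 1, ENNReal.ofReal ((1 - r) ^ (-ε) * (1 - r * R)⁻¹) := by
        rw [lintegral_add_left (by fun_prop), lintegral_const_mul _ (by fun_prop),
          lintegral_const_mul _ (by fun_prop), lintegral_Ioo_rpow (by linarith) zero_le_one,
          sub_add_cancel, Real.one_rpow]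
    _ ≤ ENNReal.ofReal 4 * ENNReal.ofReal (1 / δ) * ENNReal.ofReal ((1 - R) ^ (-ε)) +
          ENNReal.ofReal M * (ENNReal.ofReal N * ENNReal.ofReal ((1 - R) ^ (-ε))) := by
        refine add_le_add (le_mul_of_one_le_right' (ENNReal.one_le_ofReal.mpr hone)) ?_
        rw [← ENNReal.ofReal_mul hN0]
        gcongr
        exact lintegral_one_sub_rpow_neg_mul_inv_le hε0 hε1 hR0 hR1
    _ = ENNReal.ofReal (4 * (1 / δ) + M * N) * ENNReal.ofReal ((1 - R) ^ (-ε)) := by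
        rw [ENNReal.ofReal_add (p := 4 * (1 / δ)) (by positivity) (by positivity),
          ENNReal.ofReal_mul zero_le_four,
          ENNReal.ofReal_mul (by positivity)]
        ring

theorem lintegral_unitBall_inv_normSq_one_sub {a : ℂ} (ha : ‖a‖ < 1) {m : ℕ} (hm : m ≠ 0)
    {φ : ℝ → ℝ≥0∞} (hφ : Measurable φ) :
    ∫⁻ z in ball (0 : ℂ) 1, ENNReal.ofReal (‖1 - a * z ^ m‖ ^ 2)⁻¹ * φ ‖z‖ =
      ENNReal.ofReal (2 * π) * ∫⁻ r in Ioo (0 : ℝ) 1,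
        ENNReal.ofReal (r * (1 - (‖a‖ * r ^ m) ^ 2)⁻¹) * φ r := by
  rw [lintegral_ball_eq_polar 1 (by fun_prop), ← lintegral_const_mul _ (by fun_prop)]
  refine setLIntegral_congr_fun measurableSet_Ioo fun r hr => ?_
  have hr' : |r| = r := abs_of_pos hr.1
  have hlt : ‖a‖ * |r| ^ m < 1 := by
    rw [hr']
    exact mul_lt_one_of_nonneg_of_lt_one_left (norm_nonneg a) ha (pow_le_one₀ hr.1.le hr.2.le)
  have hcont : ContinuousOn (fun ζ : ℂ => (‖1 - a * ζ ^ m‖ ^ 2)⁻¹) (sphere 0 |r|) := by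
    refine ContinuousOn.inv₀ (by fun_prop) fun ζ hζ h0 => ?_
    have h1 : a * ζ ^ m = 1 := (sub_eq_zero.mp (norm_eq_zero.mp (pow_eq_zero_iff two_ne_zero |>.mp
      h0))).symm
    have := congrArg norm h1
    rw [norm_mul, norm_pow, mem_sphere_zero_iff_norm.mp hζ, norm_one] at this
    exact hlt.ne this
  have hφr (θ : ℝ) : φ ‖circleMap 0 r θ‖ = φ r := by rw [norm_circleMap_zero, hr']
  simp_rw [hφr]
  rw [lintegral_mul_const _ (by have := (continuous_circleMap 0 r).measurable; fun_prop),
    lintegral_Ioo_circleMap hcont (fun ζ => by positivity), circleAverage_inv_normSq_one_sub hm hlt,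
    hr', ENNReal.ofReal_mul two_pi_pos.le, ENNReal.ofReal_mul hr.1.le]
  ring

theorem exists_lintegral_unitBall_inv_normSq_one_sub_le {δ ε : ℝ} (hδ : 0 < δ) (hε0 : 0 < ε)
    (hε1 : ε < 1) :
    ∃ C : ℝ≥0, ∀ {m : ℕ} {a : ℂ} {R : ℝ}, m ≠ 0 → 0 ≤ R → R < 1 → ‖a‖ = R ^ m →
      ∫⁻ z in ball (0 : ℂ) 1, ENNReal.ofReal (‖1 - a * z ^ m‖ ^ 2)⁻¹ *
          ENNReal.ofReal (‖z‖ ^ (δ - 2) * (1 - ‖z‖) ^ (-ε)) ≤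
        C * ENNReal.ofReal ((1 - R) ^ (-ε)) := by
  obtain ⟨C, hC⟩ := exists_lintegral_rpow_mul_one_sub_rpow_neg_mul_inv_le hδ hε0 hε1
  refine ⟨(2 * π).toNNReal * C, fun {m a R} hm hR0 hR1 ha => ?_⟩
  rw [lintegral_unitBall_inv_normSq_one_sub (ha ▸ pow_lt_one₀ hR0 hR1 hm) hm
    (φ := fun r => ENNReal.ofReal (r ^ (δ - 2) * (1 - r) ^ (-ε))) (by fun_prop),
    ENNReal.coe_mul, mul_assoc]
  refine mul_le_mul_right ?_ (ENNReal.ofReal (2 * π))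
  refine (setLIntegral_mono' measurableSet_Ioo fun r hr => ?_).trans (hC R hR0 hR1)
  have hr0 : 0 < r := hr.1
  have hr1 : 0 < 1 - r := by linarith [hr.2]
  have hrR0 : 0 ≤ r * R := by positivity
  have hrR1 : r * R < 1 := by nlinarith [hr.2]
  have hsq : (‖a‖ * r ^ m) ^ 2 ≤ r * R := by
    rw [ha, ← mul_pow, mul_comm R, ← pow_mul]
    exact pow_le_of_le_one hrR0 hrR1.le (by positivity)
  have hinv : (1 - (‖a‖ * r ^ m) ^ 2)⁻¹ ≤ (1 - r * R)⁻¹ :=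
    inv_anti₀ (by linarith) (by linarith)
  rw [← ENNReal.ofReal_mul (mul_nonneg hr0.le (inv_nonneg.mpr (by linarith)))]
  refine ENNReal.ofReal_le_ofReal ?_
  calc r * (1 - (‖a‖ * r ^ m) ^ 2)⁻¹ * (r ^ (δ - 2) * (1 - r) ^ (-ε))
      ≤ r * (1 - r * R)⁻¹ * (r ^ (δ - 2) * (1 - r) ^ (-ε)) := by gcongr
    _ = r ^ (δ - 2) * r * (1 - r) ^ (-ε) * (1 - r * R)⁻¹ := by ring
    _ = r ^ (δ - 1) * (1 - r) ^ (-ε) * (1 - r * R)⁻¹ := by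
        rw [← Real.rpow_add_one hr0.ne', show δ - 2 + 1 = δ - 1 by ring]

/-! ### The domain -/

section Domain

variable {γ : ℝ}

theorem mem_domain_iff (hγ : 0 < γ) {z : ℂ × ℂ} :
    z ∈ domain γ ↔ ‖z.2‖ < 1 ∧ ‖z.1‖ < ‖z.2‖ ^ γ⁻¹ := by
  rw [Real.lt_rpow_inv_iff_of_pos (norm_nonneg _) (norm_nonneg _) hγ, and_comm]
  rfl

theorem snd_ne_zero_of_mem_domain {z : ℂ × ℂ} (hz : z ∈ domain γ) : z.2 ≠ 0 :=
  norm_pos_iff.mp ((Real.rpow_nonneg (norm_nonneg z.1) γ).trans_lt hz.1)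

theorem isOpen_domain (hγ : 0 < γ) : IsOpen (domain γ) := by
  have h : Continuous fun z : ℂ × ℂ => ‖z.1‖ ^ γ :=
    continuous_fst.norm.rpow_const fun _ => Or.inr hγ.le
  exact (isOpen_lt h continuous_snd.norm).inter (isOpen_lt continuous_snd.norm continuous_const)

theorem measurableSet_domain (hγ : 0 < γ) : MeasurableSet (domain γ) :=
  (isOpen_domain hγ).measurableSet

theorem isFiniteMeasure_vol (hγ : 0 < γ) : IsFiniteMeasure (vol γ) := by
  refine ⟨?_⟩
  rw [vol, Measure.restrict_apply_univ]
  refine lt_of_le_of_lt (measure_mono (t := ball (0 : ℂ × ℂ) 1) ?_) measure_ball_lt_top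
  intro z hz
  have h := (mem_domain_iff hγ).mp hz
  rw [mem_ball_zero_iff, Prod.norm_def, max_lt_iff]
  exact ⟨h.2.trans_le (Real.rpow_le_one (norm_nonneg _) h.1.le (by positivity)), h.1⟩

theorem lintegral_ball_eq_smul {E : Type*} [NormedAddCommGroup E] [NormedSpace ℝ E]
    [MeasurableSpace E] [BorelSpace E] [FiniteDimensional ℝ E] (μ : Measure E)
    [μ.IsAddHaarMeasure] {ρ : ℝ} (hρ : 0 < ρ) (f : E → ℝ≥0∞) :
    ∫⁻ x in ball 0 ρ, f x ∂μ =
      ENNReal.ofReal (ρ ^ Module.finrank ℝ E) * ∫⁻ x in ball 0 1, f (ρ • x) ∂μ := by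
  have hemb : MeasurableEmbedding (fun x : E => ρ • x) :=
    (Homeomorph.smulOfNeZero ρ hρ.ne').measurableEmbedding
  have hpre : (fun x : E => ρ • x) ⁻¹' ball 0 ρ = ball 0 1 := by
    ext x
    simp [norm_smul, abs_of_pos hρ, hρ]
  have hpow : 0 < ρ ^ Module.finrank ℝ E := by positivity
  have hscale : ∫⁻ x in ball 0 1, f (ρ • x) ∂μ =
      ENNReal.ofReal (ρ ^ Module.finrank ℝ E)⁻¹ * ∫⁻ x in ball 0 ρ, f x ∂μ := by
    rw [← hpre, ← hemb.lintegral_map, ← hemb.restrict_map, Measure.map_addHaar_smul μ hρ.ne',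
      Measure.restrict_smul, lintegral_smul_measure, abs_of_pos (inv_pos.mpr hpow), smul_eq_mul]
  rw [hscale, ← mul_assoc, ← ENNReal.ofReal_mul hpow.le, mul_inv_cancel₀ hpow.ne',
    ENNReal.ofReal_one, one_mul]

theorem lintegral_domain (hγ : 0 < γ) {F : ℂ × ℂ → ℝ≥0∞} (hF : Measurable F) :
    ∫⁻ z in domain γ, F z = ∫⁻ v in ball (0 : ℂ) 1, ENNReal.ofReal (‖v‖ ^ (2 / γ)) *
      ∫⁻ u in ball (0 : ℂ) 1, F (‖v‖ ^ γ⁻¹ • u, v) := by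
  rw [← lintegral_indicator (measurableSet_domain hγ), Measure.volume_eq_prod,
    lintegral_prod_symm _ (hF.indicator (measurableSet_domain hγ)).aemeasurable,
    ← lintegral_indicator isOpen_ball.measurableSet]
  refine lintegral_congr fun v => ?_
  have hslice (u : ℂ) : (domain γ).indicator F (u, v) =
      (ball 0 1).indicator (fun v => (ball 0 (‖v‖ ^ γ⁻¹)).indicator (fun u => F (u, v)) u) v := by
    simp only [indicator, mem_domain_iff hγ, mem_ball_zero_iff]
    split_ifs <;> tauto
  by_cases hv : v ∈ ball (0 : ℂ) 1
  · simp_rw [hslice, indicator_of_mem hv]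
    rw [lintegral_indicator isOpen_ball.measurableSet]
    rcases eq_or_ne v 0 with rfl | hv0
    · simp [hγ.ne']
    · rw [lintegral_ball_eq_smul volume (by positivity), Complex.finrank_real_complex,
        ← Real.rpow_mul_natCast (norm_nonneg v), div_eq_inv_mul, Nat.cast_ofNat]
  · simp_rw [hslice, indicator_of_notMem hv, lintegral_zero]

theorem lintegral_domain_rpow (hγ : 0 < γ) (a b : ℝ) :
    ∫⁻ w in domain γ, ENNReal.ofReal (‖w.1‖ ^ a * ‖w.2‖ ^ b) =
      (∫⁻ u in ball (0 : ℂ) 1, ENNReal.ofReal (‖u‖ ^ a)) *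
        ∫⁻ v in ball (0 : ℂ) 1, ENNReal.ofReal (‖v‖ ^ ((a + 2) / γ + b)) := by
  rw [lintegral_domain hγ (by fun_prop), ← lintegral_const_mul _ (by fun_prop)]
  refine lintegral_congr_ae ?_
  filter_upwards [(Measure.ae_ne _ 0 : ∀ᵐ v : ℂ ∂volume.restrict (ball (0 : ℂ) 1), v ≠ 0)]
    with v hv
  have hv0 : 0 < ‖v‖ := norm_pos_iff.mpr hv
  have hnorm (u : ℂ) : ENNReal.ofReal (‖‖v‖ ^ γ⁻¹ • u‖ ^ a * ‖v‖ ^ b) =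
      ENNReal.ofReal (‖v‖ ^ (a / γ + b)) * ENNReal.ofReal (‖u‖ ^ a) := by
    rw [norm_smul, Real.norm_of_nonneg (by positivity),
      Real.mul_rpow (by positivity) (norm_nonneg u), ← Real.rpow_mul hv0.le,
      ← ENNReal.ofReal_mul (by positivity), Real.rpow_add hv0, inv_mul_eq_div]
    ring_nf
  simp_rw [hnorm]
  rw [lintegral_const_mul _ (by fun_prop), ← mul_assoc, ← ENNReal.ofReal_mul (by positivity),
    ← Real.rpow_add hv0, mul_comm]
  ring_nf

theorem lintegral_domain_rpow_ne_top_iff (hγ : 0 < γ) {a b : ℝ} :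
    ∫⁻ w in domain γ, ENNReal.ofReal (‖w.1‖ ^ a * ‖w.2‖ ^ b) ≠ ∞ ↔
      -2 < a ∧ 0 < (a + 2) / γ + b + 2 := by
  rw [lintegral_domain_rpow hγ]
  rcases le_or_gt a (-2) with ha | ha
  · simp [lintegral_unitBall_norm_rpow_eq_top ha, ENNReal.top_mul,
      lintegral_unitBall_norm_rpow_ne_zero, ha.not_gt]
  rcases le_or_gt ((a + 2) / γ + b) (-2) with hb | hb
  · simp [lintegral_unitBall_norm_rpow_eq_top hb, ENNReal.mul_top,
      lintegral_unitBall_norm_rpow_ne_zero, ha, not_lt.mpr (by linarith : (a + 2) / γ + b + 2 ≤ 0)]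
  · simp [lintegral_unitBall_norm_rpow ha, lintegral_unitBall_norm_rpow hb, ENNReal.mul_ne_top, ha,
      (by linarith : 0 < (a + 2) / γ + b + 2)]

end Domain

/-! ### Monomials -/

theorem norm_monomial (α : ℤ × ℤ) (z : ℂ × ℂ) :
    ‖monomial α z‖ = ‖z.1‖ ^ α.1 * ‖z.2‖ ^ α.2 := by
  simp [monomial]

@[fun_prop]
theorem measurable_monomial (α : ℤ × ℤ) : Measurable (monomial α) := by
  unfold monomial
  fun_prop

theorem enorm_monomial_rpow (α : ℤ × ℤ) {p : ℝ} (hp : 0 ≤ p) (z : ℂ × ℂ) :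
    ‖monomial α z‖ₑ ^ p = ENNReal.ofReal (‖z.1‖ ^ (α.1 * p) * ‖z.2‖ ^ (α.2 * p)) := by
  rw [← ofReal_norm, ENNReal.ofReal_rpow_of_nonneg (norm_nonneg _) hp, norm_monomial,
    Real.mul_rpow (by positivity) (by positivity), Real.rpow_mul (norm_nonneg _),
    Real.rpow_mul (norm_nonneg _), Real.rpow_intCast, Real.rpow_intCast]

section Monomials

variable {γ : ℝ} {p : ℝ≥0∞} {α : ℤ × ℤ}

theorem differentiableOn_monomial (hα : 0 ≤ α.1) :
    DifferentiableOn ℂ (monomial α) (domain γ) := by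
  intro z hz
  have h2 := snd_ne_zero_of_mem_domain hz
  refine DifferentiableAt.differentiableWithinAt ?_
  exact (differentiableAt_fst.zpow (Or.inr hα)).mul (differentiableAt_snd.zpow (Or.inl h2))

theorem lintegral_enorm_monomial_rpow_ne_top_iff (hγ : 0 < γ) {s : ℝ} (hs : 2 ≤ s) :
    ∫⁻ v in domain γ, ‖monomial α v‖ₑ ^ s ≠ ∞ ↔
      0 ≤ α.1 ∧ 0 < (α.1 * s + 2) / γ + α.2 * s + 2 := by
  have hfst : -2 < α.1 * s ↔ 0 ≤ α.1 := by
    constructor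
    · intro h
      by_contra! hneg
      have : (α.1 : ℝ) ≤ -1 := by exact_mod_cast Int.le_sub_one_of_lt hneg
      nlinarith
    · intro h
      have : (0 : ℝ) ≤ α.1 := by exact_mod_cast h
      nlinarith
  simp_rw [enorm_monomial_rpow α (by linarith : 0 ≤ s)]
  rw [lintegral_domain_rpow_ne_top_iff hγ, hfst]

theorem mem_allowable_iff_lintegral_ne_top (hγ : 0 < γ) (hp : 2 ≤ p) (hp' : p ≠ ∞) :
    α ∈ allowable γ p ↔ ∫⁻ v in domain γ, ‖monomial α v‖ₑ ^ p.toReal ≠ ∞ := by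
  have hp0 : p ≠ 0 := (zero_lt_two.trans_le hp).ne'
  have hpr : 2 ≤ p.toReal := by simpa using ENNReal.toReal_mono hp' hp
  have hmem : MemLp (monomial α) p (vol γ) ↔
      ∫⁻ v in domain γ, ‖monomial α v‖ₑ ^ p.toReal ≠ ∞ := by
    rw [MemLp, and_iff_right (measurable_monomial α).aestronglyMeasurable,
      eLpNorm_lt_top_iff_lintegral_rpow_enorm_lt_top hp0 hp', lt_top_iff_ne_top]
    rfl
  refine ⟨fun h => hmem.mp h.2, fun h => ⟨differentiableOn_monomial ?_, hmem.mpr h⟩⟩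
  exact ((lintegral_enorm_monomial_rpow_ne_top_iff hγ hpr).mp h).1

theorem mem_allowable_iff (hγ : 0 < γ) (hp : 2 ≤ p) (hp' : p ≠ ∞) :
    α ∈ allowable γ p ↔ 0 ≤ α.1 ∧ 0 < (α.1 * p.toReal + 2) / γ + α.2 * p.toReal + 2 := by
  rw [mem_allowable_iff_lintegral_ne_top hγ hp hp', lintegral_enorm_monomial_rpow_ne_top_iff hγ]
  simpa using ENNReal.toReal_mono hp' hp

theorem allowable_subset_two (hγ : 0 < γ) (hp : 2 ≤ p) : allowable γ p ⊆ allowable γ 2 :=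
  fun _ hα =>
    have := isFiniteMeasure_vol hγ
    ⟨hα.1, hα.2.mono_exponent hp⟩

/-- The slack `(α₁ + 1)/γ + α₂ + 1` in the condition for `e_α` to be square integrable. It is the
variable in which the allowable monomials behave like the monomials of a bidisc. -/
def excess (γ : ℝ) (α : ℤ × ℤ) : ℝ := (α.1 + 1) / γ + α.2 + 1

theorem mem_allowable_two_iff (hγ : 0 < γ) :
    α ∈ allowable γ 2 ↔ 0 ≤ α.1 ∧ 0 < excess γ α := by
  rw [mem_allowable_iff hγ le_rfl (by simp), ENNReal.toReal_ofNat,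
    show (α.1 * 2 + 2 : ℝ) / γ + α.2 * 2 + 2 = 2 * excess γ α by rw [excess]; ring]
  simp

theorem integral_sq_norm_monomial (hγ : 0 < γ) (hα : α ∈ allowable γ 2) :
    ∫ v in domain γ, ‖monomial α v‖ ^ 2 = π ^ 2 / ((α.1 + 1) * excess γ α) := by
  obtain ⟨h1, h2⟩ := (mem_allowable_two_iff hγ).mp hα
  have h1' : (0 : ℝ) ≤ α.1 := by exact_mod_cast h1
  have hsq (v : ℂ × ℂ) : ENNReal.ofReal (‖monomial α v‖ ^ 2) =
      ENNReal.ofReal (‖v.1‖ ^ (α.1 * 2 : ℝ) * ‖v.2‖ ^ (α.2 * 2 : ℝ)) := by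
    rw [← enorm_monomial_rpow α zero_le_two, ← ofReal_norm,
      ENNReal.ofReal_rpow_of_nonneg (norm_nonneg _) zero_le_two, Real.rpow_two]
  have hexp : (α.1 * 2 + 2 : ℝ) / γ + α.2 * 2 + 2 = 2 * excess γ α := by
    rw [excess]
    ring
  rw [integral_eq_lintegral_of_nonneg_ae (Filter.Eventually.of_forall fun v => by positivity)
    (by fun_prop)]
  simp_rw [hsq]
  rw [lintegral_domain_rpow hγ, lintegral_unitBall_norm_rpow (by linarith),
    lintegral_unitBall_norm_rpow (by linarith), hexp, ENNReal.toReal_mul,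
    ENNReal.toReal_ofReal (by positivity), ENNReal.toReal_ofReal (by positivity)]
  field_simp

end Monomials

theorem differentiableOn_tsum_of_locally_summable {ι E : Type*} [NormedAddCommGroup E]
    [NormedSpace ℂ E] {s : Set E} (hs : IsOpen s) {f : ι → E → ℂ}
    (hf : ∀ i, DifferentiableOn ℂ (f i) s)
    (hb : ∀ z ∈ s, ∃ U ∈ nhds z, ∃ u : ι → ℝ, Summable u ∧ ∀ i, ∀ w ∈ U, ‖f i w‖ ≤ u i) :
    DifferentiableOn ℂ (fun z => ∑' i, f i z) s := by
  intro z hz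
  obtain ⟨U, hU, u, hu, hbd⟩ := hb z hz
  obtain ⟨ε, hε, hball⟩ := Metric.mem_nhds_iff.mp (Filter.inter_mem hU (hs.mem_nhds hz))
  have hr : 0 < ε / 2 := by positivity
  have hsub {w : E} (hw : w ∈ ball z (ε / 2)) : ball w (ε / 2) ⊆ U ∩ s :=
    (ball_subset_ball' (by linarith [mem_ball.mp hw])).trans hball
  have hdiff (i : ι) {w : E} (hw : w ∈ ball z (ε / 2)) :
      DifferentiableOn ℂ (f i) (ball w (ε / 2)) :=
    (hf i).mono fun x hx => (hsub hw hx).2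
  -- Cauchy's estimate, from the Schwarz lemma
  have hderiv (i : ι) {w : E} (hw : w ∈ ball z (ε / 2)) :
      ‖fderiv ℂ (f i) w‖ ≤ (u i + u i) / (ε / 2) := by
    refine Complex.norm_fderiv_le_div_of_mapsTo_ball (hdiff i hw) (fun x hx => ?_) hr
    rw [mem_closedBall_iff_norm]
    exact (norm_sub_le _ _).trans
      (add_le_add (hbd i x (hsub hw hx).1) (hbd i w (hsub hw (mem_ball_self hr)).1))
  have hzb : z ∈ ball z (ε / 2) := mem_ball_self hr
  refine (hasFDerivAt_tsum_of_isPreconnected ((hu.add hu).div_const _) isOpen_ball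
    (convex_ball z (ε / 2)).isPreconnected (fun i w hw => ?_) (fun i w hw => hderiv i hw) hzb
    (Summable.of_norm_bounded hu fun i => hbd i z (mem_of_mem_nhds hU))
    hzb).differentiableAt.differentiableWithinAt
  exact ((hdiff i hw).differentiableAt (ball_mem_nhds w hr)).hasFDerivAt

/-! ### Summability of the kernel series -/

theorem norm_monomial_eq_pow_mul_rpow_excess (γ : ℝ) {z : ℂ × ℂ} (hz : z.2 ≠ 0) (k : ℕ) (j : ℤ) :
    ‖monomial (k, j) z‖ =
      (‖z.1‖ / ‖z.2‖ ^ γ⁻¹) ^ k * ‖z.2‖ ^ (excess γ (k, j) - (γ⁻¹ + 1)) := by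
  have hz0 : 0 < ‖z.2‖ := norm_pos_iff.mpr hz
  have hexp : excess γ (k, j) - (γ⁻¹ + 1) = γ⁻¹ * k + j := by
    simp only [excess, Int.cast_natCast]
    ring
  rw [norm_monomial, hexp, Real.rpow_add hz0, Real.rpow_mul hz0.le, Real.rpow_natCast,
    Real.rpow_intCast, zpow_natCast, ← mul_assoc, ← mul_pow, div_mul_cancel₀]
  exact (Real.rpow_pos_of_pos hz0 _).ne'

/-- The exponents of the bidisc monomial to which `e_α` is compared. -/
def bidiscIndex (γ : ℝ) (α : ℤ × ℤ) : ℕ × ℕ := (α.1.toNat, (⌈excess γ α⌉ - 1).toNat)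

theorem summable_succ_mul_geometric {y : ℝ} (hy0 : 0 ≤ y) (hy1 : y < 1) :
    Summable fun k : ℕ => ((k : ℝ) + 1) * y ^ k := by
  have h1 : Summable fun k : ℕ => (k : ℝ) * y ^ k := by
    simpa using summable_pow_mul_geometric_of_norm_lt_one 1
      (by rwa [Real.norm_of_nonneg hy0] : ‖y‖ < 1)
  exact (h1.add (summable_geometric_of_lt_one hy0 hy1)).congr fun k => by ring

/-- The squared `L^2` norm of a monomial. -/
def monomialNormSq (γ : ℝ) (α : ℤ × ℤ) : ℝ := ∫ v in domain γ, ‖monomial α v‖ ^ 2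

section Summability

variable {γ : ℝ} {α : ℤ × ℤ} {p : ℝ≥0∞} {z w : ℂ × ℂ}

theorem fst_bidiscIndex (hγ : 0 < γ) (hα : α ∈ allowable γ 2) :
    ((bidiscIndex γ α).1 : ℤ) = α.1 :=
  Int.toNat_of_nonneg ((mem_allowable_two_iff hγ).mp hα).1

theorem snd_bidiscIndex_lt_excess_le (hγ : 0 < γ) (hα : α ∈ allowable γ 2) :
    (bidiscIndex γ α).2 < excess γ α ∧ excess γ α ≤ (bidiscIndex γ α).2 + 1 := by
  have hceil : 1 ≤ ⌈excess γ α⌉ := Int.one_le_ceil_iff.mpr ((mem_allowable_two_iff hγ).mp hα).2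
  have hcast : ((bidiscIndex γ α).2 : ℝ) = ⌈excess γ α⌉ - 1 := by
    have : ((bidiscIndex γ α).2 : ℤ) = ⌈excess γ α⌉ - 1 := Int.toNat_of_nonneg (by omega)
    exact_mod_cast this
  rw [hcast]
  exact ⟨by linarith [Int.ceil_lt_add_one (excess γ α)], by linarith [Int.le_ceil (excess γ α)]⟩

theorem injOn_bidiscIndex (hγ : 0 < γ) : InjOn (bidiscIndex γ) (allowable γ 2) := by
  intro α hα β hβ h
  have hfst : α.1 = β.1 := by rw [← fst_bidiscIndex hγ hα, ← fst_bidiscIndex hγ hβ, h]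
  have hα' := snd_bidiscIndex_lt_excess_le hγ hα
  have hβ' := snd_bidiscIndex_lt_excess_le hγ hβ
  rw [h] at hα'
  have hsub : excess γ α - excess γ β = α.2 - β.2 := by
    rw [excess, excess, hfst]
    ring
  have h1 : α.2 < β.2 + 1 := by exact_mod_cast (by linarith : (α.2 : ℝ) < β.2 + 1)
  have h2 : β.2 < α.2 + 1 := by exact_mod_cast (by linarith : (β.2 : ℝ) < α.2 + 1)
  exact Prod.ext hfst (by omega)

theorem inv_monomialNormSq (hγ : 0 < γ) (hα : α ∈ allowable γ 2) :
    (monomialNormSq γ α)⁻¹ = (α.1 + 1) * excess γ α / π ^ 2 := by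
  rw [monomialNormSq, integral_sq_norm_monomial hγ hα, inv_div]

theorem monomialNormSq_pos (hγ : 0 < γ) (hα : α ∈ allowable γ 2) : 0 < monomialNormSq γ α := by
  obtain ⟨h1, h2⟩ := (mem_allowable_two_iff hγ).mp hα
  have : (0 : ℝ) ≤ α.1 := by exact_mod_cast h1
  rw [← inv_pos, inv_monomialNormSq hγ hα]
  positivity

theorem one_add_inv_monomialNormSq_le (hγ : 0 < γ) (hα : α ∈ allowable γ 2) :
    1 + (monomialNormSq γ α)⁻¹ ≤
      2 * (((bidiscIndex γ α).1 + 1) * ((bidiscIndex γ α).2 + 1)) := by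
  have hE := (snd_bidiscIndex_lt_excess_le hγ hα).2
  have hfst : (α.1 : ℝ) = (bidiscIndex γ α).1 := by exact_mod_cast (fst_bidiscIndex hγ hα).symm
  have hE0 := ((mem_allowable_two_iff hγ).mp hα).2
  rw [inv_monomialNormSq hγ hα, hfst]
  generalize (bidiscIndex γ α).1 = k, (bidiscIndex γ α).2 = l at hE ⊢
  have hk : (1 : ℝ) ≤ k + 1 := by simp
  have hl : (1 : ℝ) ≤ l + 1 := by simp
  have hinv : ((k : ℝ) + 1) * excess γ α / π ^ 2 ≤ (k + 1) * (l + 1) :=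
    (div_le_self (by positivity) (by nlinarith [pi_gt_three])).trans (by gcongr)
  linarith [one_le_mul_of_one_le_of_one_le hk hl]

theorem norm_monomial_le_of_mem_domain (hγ : 0 < γ) (hz : z ∈ domain γ)
    (hα : α ∈ allowable γ 2) :
    ‖monomial α z‖ ≤ ‖z.2‖ ^ (-(γ⁻¹ + 1)) *
      ((‖z.1‖ / ‖z.2‖ ^ γ⁻¹) ^ (bidiscIndex γ α).1 * ‖z.2‖ ^ (bidiscIndex γ α).2) := by
  have hz2 := snd_ne_zero_of_mem_domain hz
  have hR0 : 0 < ‖z.2‖ := norm_pos_iff.mpr hz2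
  have hlt := (snd_bidiscIndex_lt_excess_le hγ hα).1
  have hα' : α = (((bidiscIndex γ α).1 : ℤ), α.2) := Prod.ext (fst_bidiscIndex hγ hα).symm rfl
  have hnorm := norm_monomial_eq_pow_mul_rpow_excess γ hz2 (bidiscIndex γ α).1 α.2
  rw [← hα'] at hnorm
  calc ‖monomial α z‖
      = (‖z.1‖ / ‖z.2‖ ^ γ⁻¹) ^ (bidiscIndex γ α).1 * ‖z.2‖ ^ (excess γ α - (γ⁻¹ + 1)) := hnorm
    _ ≤ (‖z.1‖ / ‖z.2‖ ^ γ⁻¹) ^ (bidiscIndex γ α).1 *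
          ‖z.2‖ ^ ((bidiscIndex γ α).2 + -(γ⁻¹ + 1)) := by
        gcongr ?_ * ?_
        exact Real.rpow_le_rpow_of_exponent_ge hR0 hz.2.le (by linarith)
    _ = _ := by
        rw [Real.rpow_add hR0, Real.rpow_natCast]
        ring

theorem summable_norm_monomial (hγ : 0 < γ) (hp : 2 ≤ p) (hz : z ∈ domain γ) :
    Summable fun α : allowable γ p => ‖monomial α z‖ * (1 + (monomialNormSq γ α)⁻¹) := by
  have hR0 : 0 < ‖z.2‖ := norm_pos_iff.mpr (snd_ne_zero_of_mem_domain hz)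
  have hx : ‖z.1‖ / ‖z.2‖ ^ γ⁻¹ < 1 :=
    (div_lt_one (by positivity)).mpr ((mem_domain_iff hγ).mp hz).2
  have hsub := allowable_subset_two hγ hp
  have hinj : Function.Injective fun α : allowable γ p => bidiscIndex γ α :=
    ((injOn_bidiscIndex hγ).mono hsub).injective
  have hprod := (summable_succ_mul_geometric (by positivity) hx).mul_of_nonneg
    (summable_succ_mul_geometric hR0.le hz.2) (fun k => by positivity) fun k => by positivity
  refine Summable.of_nonneg_of_le (fun α => ?_) (fun α => ?_)
    ((hprod.comp_injective hinj).mul_left (2 * ‖z.2‖ ^ (-(γ⁻¹ + 1))))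
  · have := monomialNormSq_pos hγ (hsub α.2)
    positivity
  · refine (mul_le_mul (norm_monomial_le_of_mem_domain hγ hz (hsub α.2))
      (one_add_inv_monomialNormSq_le hγ (hsub α.2)) ?_ (by positivity)).trans_eq ?_
    · have := monomialNormSq_pos hγ (hsub α.2)
      positivity
    · simp only [Function.comp_apply]
      ring

theorem monomial_mul (α : ℤ × ℤ) (z w : ℂ × ℂ) :
    monomial α (z * w) = monomial α z * monomial α w := by
  simp only [monomial, Prod.fst_mul, Prod.snd_mul, mul_zpow]
  ring

theorem mul_mem_domain (hγ : 0 < γ) (hz : z ∈ domain γ) (hw : w ∈ domain γ) :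
    z * w ∈ domain γ := by
  rw [mem_domain_iff hγ] at *
  simp only [Prod.fst_mul, Prod.snd_mul, norm_mul]
  rw [Real.mul_rpow (norm_nonneg _) (norm_nonneg _)]
  exact ⟨mul_lt_one_of_nonneg_of_lt_one_left (norm_nonneg _) hz.1 hw.1.le,
    mul_lt_mul'' hz.2 hw.2 (norm_nonneg _) (norm_nonneg _)⟩

theorem summable_kernelTerm (hγ : 0 < γ) (hp : 2 ≤ p) (hz : z ∈ domain γ) (hw : w ∈ domain γ) :
    Summable fun α : allowable γ p => kernelTerm γ z w α := by
  refine Summable.of_norm_bounded (summable_norm_monomial hγ hp (mul_mem_domain hγ hz hw))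
    fun α => ?_
  have hN := monomialNormSq_pos hγ (allowable_subset_two hγ hp α.2)
  have hnorm : ‖kernelTerm γ z w α‖ = ‖monomial α (z * w)‖ * (monomialNormSq γ α)⁻¹ := by
    rw [kernelTerm, norm_div, norm_mul, RCLike.norm_conj, monomial_mul, norm_mul, div_eq_mul_inv]
    exact congrArg (_ * ·⁻¹) (Complex.norm_of_nonneg hN.le)
  rw [hnorm]
  gcongr
  linarith

theorem pow_mul_zpow_le_add {x y x' a b : ℝ} (k : ℕ) (j : ℤ) (hx : 0 ≤ x) (hxx : x ≤ x')
    (ha : 0 < a) (hay : a ≤ y) (hyb : y ≤ b) :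
    x ^ k * y ^ j ≤ x' ^ k * a ^ j + x' ^ k * b ^ j := by
  have hy : 0 < y := ha.trans_le hay
  have hb : 0 < b := hy.trans_le hyb
  have hsum : y ^ j ≤ a ^ j + b ^ j := by
    rcases le_total 0 j with hj | hj
    · exact (zpow_le_zpow_left₀ hj hy.le hyb).trans (le_add_of_nonneg_left (by positivity))
    · obtain ⟨l, rfl⟩ : ∃ l : ℕ, j = -l := ⟨j.natAbs, by omega⟩
      simp only [zpow_neg, zpow_natCast]
      exact le_add_of_le_of_nonneg (by gcongr) (by positivity)
  have hx' : 0 ≤ x' := hx.trans hxx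
  rw [← mul_add]
  gcongr

theorem exists_nhds_norm_monomial_le (hγ : 0 < γ) (hz : z ∈ domain γ) :
    ∃ U ∈ nhds z, ∃ a ∈ domain γ, ∃ b ∈ domain γ, ∀ α : ℤ × ℤ, 0 ≤ α.1 → ∀ w ∈ U,
      ‖monomial α w‖ ≤ ‖monomial α a‖ + ‖monomial α b‖ := by
  have hz2 : 0 < ‖z.2‖ := norm_pos_iff.mpr (snd_ne_zero_of_mem_domain hz)
  have hmem (σ : ℝ) : ∀ᶠ δ : ℝ in nhdsWithin 0 (Ioi 0),
      (((‖z.1‖ + δ : ℝ) : ℂ), ((‖z.2‖ + σ * δ : ℝ) : ℂ)) ∈ domain γ := by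
    have hc : Continuous fun δ : ℝ =>
        (((‖z.1‖ + δ : ℝ) : ℂ), ((‖z.2‖ + σ * δ : ℝ) : ℂ)) := by fun_prop
    exact (hc.tendsto 0).eventually ((isOpen_domain hγ).mem_nhds (by simpa [domain] using hz))
      |>.filter_mono nhdsWithin_le_nhds
  have hsmall : ∀ᶠ δ : ℝ in nhdsWithin 0 (Ioi 0), δ < ‖z.2‖ :=
    (eventually_lt_nhds hz2).filter_mono nhdsWithin_le_nhds
  obtain ⟨δ, ha, hb, hδ, hδ0 : 0 < δ⟩ :=
    ((hmem (-1)).and ((hmem 1).and (hsmall.and eventually_mem_nhdsWithin))).exists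
  rw [neg_one_mul, ← sub_eq_add_neg] at ha
  rw [one_mul] at hb
  have hδ2 : 0 < ‖z.2‖ - δ := sub_pos.mpr hδ
  refine ⟨{w | ‖w.1‖ < ‖z.1‖ + δ ∧ ‖z.2‖ - δ < ‖w.2‖ ∧ ‖w.2‖ < ‖z.2‖ + δ}, ?_, _, ha, _, hb, ?_⟩
  · have hc1 : Continuous fun w : ℂ × ℂ => ‖w.1‖ := by fun_prop
    have hc2 : Continuous fun w : ℂ × ℂ => ‖w.2‖ := by fun_prop
    exact (hc1.tendsto z |>.eventually_lt_const (lt_add_of_pos_right _ hδ0)).and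
      ((hc2.tendsto z |>.eventually_const_lt (sub_lt_self _ hδ0)).and
        (hc2.tendsto z |>.eventually_lt_const (lt_add_of_pos_right _ hδ0)))
  · rintro ⟨i, j⟩ hi w ⟨h1, h2, h3⟩
    lift i to ℕ using hi
    simp only [norm_monomial, zpow_natCast]
    rw [Complex.norm_of_nonneg (by positivity : 0 ≤ ‖z.1‖ + δ), Complex.norm_of_nonneg hδ2.le,
      Complex.norm_of_nonneg (by positivity : 0 ≤ ‖z.2‖ + δ)]
    exact pow_mul_zpow_le_add i j (norm_nonneg _) h1.le hδ2 h2.le h3.le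

end Summability

/-! ### The integral operator as a series -/

theorem integrable_tsum_of_summable_integral_norm {ι X : Type*} [Countable ι]
    [MeasurableSpace X] {μ : Measure X} {F : ι → X → ℂ} (hF : ∀ i, Integrable (F i) μ)
    (hs : Summable fun i => ∫ x, ‖F i x‖ ∂μ) (hp : ∀ᵐ x ∂μ, Summable fun i => F i x) :
    Integrable (fun x => ∑' i, F i x) μ := by
  refine ⟨aestronglyMeasurable_of_tendsto_ae Filter.atTop
    (f := fun (s : Finset ι) x => ∑ i ∈ s, F i x)
    (fun s => Finset.aestronglyMeasurable_fun_sum s fun i _ => (hF i).1)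
    (hp.mono fun x hx => hx.hasSum), ?_⟩
  calc ∫⁻ x, ‖∑' i, F i x‖ₑ ∂μ
      ≤ ∫⁻ x, ∑' i, ‖F i x‖ₑ ∂μ := lintegral_mono fun x => enorm_tsum_le_tsum_enorm
    _ = ∑' i, ENNReal.ofReal (∫ x, ‖F i x‖ ∂μ) := by
        rw [lintegral_tsum fun i => (hF i).1.enorm]
        exact tsum_congr fun i => (ofReal_integral_norm_eq_lintegral_enorm (hF i)).symm
    _ < ∞ := hs.tsum_ofReal_lt_top

/-- The coefficient of `f` along the monomial `e_α`. -/
def monomialCoeff (γ : ℝ) (f : ℂ × ℂ → ℂ) (α : ℤ × ℤ) : ℂ :=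
  (∫ w in domain γ, conj (monomial α w) * f w) / (monomialNormSq γ α : ℂ)

section IntegralOperator

variable {γ : ℝ} {α : ℤ × ℤ} {p : ℝ≥0∞} {f : ℂ × ℂ → ℂ} {z : ℂ × ℂ}

theorem integrable_conj_monomial_mul (hα : α ∈ allowable γ 2) (hf : MemLp f 2 (vol γ)) :
    Integrable (fun w => conj (monomial α w) * f w) (vol γ) :=
  hα.2.star.integrable_mul hf

theorem integral_norm_conj_monomial_mul_le (hα : α ∈ allowable γ 2) (hf : MemLp f 2 (vol γ)) :
    ∫ w, ‖conj (monomial α w) * f w‖ ∂(vol γ) ≤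
      monomialNormSq γ α + ∫ w, ‖f w‖ ^ 2 ∂(vol γ) := by
  have hα2 : Integrable (fun w => ‖monomial α w‖ ^ 2) (vol γ) :=
    hα.2.integrable_norm_pow two_ne_zero
  have hf2 : Integrable (fun w => ‖f w‖ ^ 2) (vol γ) := hf.integrable_norm_pow two_ne_zero
  refine (integral_mono (integrable_conj_monomial_mul hα hf).norm (hα2.add hf2)
    fun w => ?_).trans_eq (integral_add hα2 hf2)
  simp only [norm_mul, RCLike.norm_conj, Pi.add_apply]
  nlinarith [two_mul_le_add_sq ‖monomial α w‖ ‖f w‖,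
    mul_nonneg (norm_nonneg (monomial α w)) (norm_nonneg (f w))]

theorem kernelTerm_mul (γ : ℝ) (z w : ℂ × ℂ) (α : ℤ × ℤ) (c : ℂ) :
    kernelTerm γ z w α * c =
      monomial α z / (monomialNormSq γ α : ℂ) * (conj (monomial α w) * c) := by
  simp only [kernelTerm, monomialNormSq]
  ring

theorem integrable_kernelTerm_mul (z : ℂ × ℂ) (hα : α ∈ allowable γ 2) (hf : MemLp f 2 (vol γ)) :
    Integrable (fun w => kernelTerm γ z w α * f w) (vol γ) := by
  simp_rw [kernelTerm_mul]
  exact (integrable_conj_monomial_mul hα hf).const_mul _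

theorem integral_kernelTerm_mul (γ : ℝ) (f : ℂ × ℂ → ℂ) (z : ℂ × ℂ) (α : ℤ × ℤ) :
    ∫ w, kernelTerm γ z w α * f w ∂(vol γ) = monomial α z * monomialCoeff γ f α := by
  simp_rw [kernelTerm_mul]
  rw [integral_const_mul, monomialCoeff, vol]
  ring

theorem integral_norm_kernelTerm_mul_le (hγ : 0 < γ) (z : ℂ × ℂ) (hα : α ∈ allowable γ 2)
    (hf : MemLp f 2 (vol γ)) :
    ∫ w, ‖kernelTerm γ z w α * f w‖ ∂(vol γ) ≤
      (1 + ∫ w, ‖f w‖ ^ 2 ∂(vol γ)) * (‖monomial α z‖ * (1 + (monomialNormSq γ α)⁻¹)) := by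
  have hN := monomialNormSq_pos hγ hα
  have hF : 0 ≤ ∫ w, ‖f w‖ ^ 2 ∂(vol γ) := by positivity
  simp_rw [kernelTerm_mul, norm_mul _ (conj _ * _)]
  rw [integral_const_mul, norm_div, Complex.norm_of_nonneg hN.le]
  calc ‖monomial α z‖ / monomialNormSq γ α * ∫ w, ‖conj (monomial α w) * f w‖ ∂(vol γ)
      ≤ ‖monomial α z‖ / monomialNormSq γ α *
          (monomialNormSq γ α + ∫ w, ‖f w‖ ^ 2 ∂(vol γ)) := by
        gcongr
        exact integral_norm_conj_monomial_mul_le hα hf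
    _ = ‖monomial α z‖ * (1 + (∫ w, ‖f w‖ ^ 2 ∂(vol γ)) * (monomialNormSq γ α)⁻¹) := by
        field_simp
    _ ≤ ‖monomial α z‖ * ((1 + ∫ w, ‖f w‖ ^ 2 ∂(vol γ)) * (1 + (monomialNormSq γ α)⁻¹)) := by
        gcongr
        nlinarith [inv_pos.mpr hN]
    _ = _ := mul_left_comm _ _ _

theorem summable_integral_norm_kernelTerm_mul (hγ : 0 < γ) (hp : 2 ≤ p) (hf : MemLp f 2 (vol γ))
    (hz : z ∈ domain γ) :
    Summable fun α : allowable γ p => ∫ w, ‖kernelTerm γ z w α * f w‖ ∂(vol γ) :=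
  Summable.of_nonneg_of_le (fun α => by positivity)
    (fun α => integral_norm_kernelTerm_mul_le hγ z (allowable_subset_two hγ hp α.2) hf)
    ((summable_norm_monomial hγ hp hz).mul_left _)

theorem summable_norm_monomial_mul_coeff (hγ : 0 < γ) (hp : 2 ≤ p) (hf : MemLp f 2 (vol γ))
    (hz : z ∈ domain γ) :
    Summable fun α : allowable γ p => ‖monomial α z‖ * ‖monomialCoeff γ f α‖ := by
  refine Summable.of_nonneg_of_le (fun α => by positivity) (fun α => ?_)
    (summable_integral_norm_kernelTerm_mul hγ hp hf hz)
  rw [← norm_mul, ← integral_kernelTerm_mul]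
  exact norm_integral_le_integral_norm _

theorem subBergmanKernel_mul (γ : ℝ) (p : ℝ≥0∞) (z w : ℂ × ℂ) (c : ℂ) :
    subBergmanKernel γ p z w * c = ∑' α : allowable γ p, kernelTerm γ z w α * c :=
  tsum_mul_right.symm

theorem integrableOn_subBergmanKernel_mul (hγ : 0 < γ) (hp : 2 ≤ p) (hf : MemLp f 2 (vol γ))
    (hz : z ∈ domain γ) :
    IntegrableOn (fun w => subBergmanKernel γ p z w * f w) (domain γ) := by
  simp_rw [subBergmanKernel_mul]
  refine integrable_tsum_of_summable_integral_norm
    (fun α => integrable_kernelTerm_mul z (allowable_subset_two hγ hp α.2) hf)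
    (summable_integral_norm_kernelTerm_mul hγ hp hf hz) ?_
  filter_upwards [ae_restrict_mem (measurableSet_domain hγ)] with w hw
  exact (summable_kernelTerm hγ hp hz hw).mul_right _

theorem hasSum_integralOp (hγ : 0 < γ) (hp : 2 ≤ p) (hf : MemLp f 2 (vol γ))
    (hz : z ∈ domain γ) :
    HasSum (fun α : allowable γ p => monomial α z * monomialCoeff γ f α)
      (integralOp γ (subBergmanKernel γ p) f z) := by
  have h := hasSum_integral_of_summable_integral_norm
    (fun α : allowable γ p => integrable_kernelTerm_mul z (allowable_subset_two hγ hp α.2) hf)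
    (summable_integral_norm_kernelTerm_mul hγ hp hf hz)
  simp_rw [integral_kernelTerm_mul, ← subBergmanKernel_mul] at h
  exact h

theorem differentiableOn_integralOp (hγ : 0 < γ) (hp : 2 ≤ p) (hf : MemLp f 2 (vol γ)) :
    DifferentiableOn ℂ (integralOp γ (subBergmanKernel γ p) f) (domain γ) := by
  refine DifferentiableOn.congr ?_ fun z hz => (hasSum_integralOp hγ hp hf hz).tsum_eq.symm
  refine differentiableOn_tsum_of_locally_summable (isOpen_domain hγ)
    (fun α => α.2.1.mul_const _) fun z hz => ?_
  obtain ⟨U, hU, a, ha, b, hb, hab⟩ := exists_nhds_norm_monomial_le hγ hz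
  refine ⟨U, hU, _, (summable_norm_monomial_mul_coeff hγ hp hf ha).add
    (summable_norm_monomial_mul_coeff hγ hp hf hb), fun α w hw => ?_⟩
  rw [norm_mul, ← add_mul]
  gcongr
  exact hab _ ((mem_allowable_two_iff hγ).mp (allowable_subset_two hγ hp α.2)).1 w hw

end IntegralOperator

/-! ### Torus averages -/

/-- The point of the two-dimensional unit torus in `ℂ²` with the given angles; the torus acts on
`ℂ²` by multiplication with these points. -/
def torusPoint (θ : UnitAddCircle × UnitAddCircle) : ℂ × ℂ := (θ.1.toCircle, θ.2.toCircle)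

/-- The normalized Haar measure of the two-dimensional torus. -/
abbrev torusMeasure : Measure (UnitAddCircle × UnitAddCircle) :=
  AddCircle.haarAddCircle.prod AddCircle.haarAddCircle

/-- The average of `G` over the torus through `z`. -/
def torusMean (G : ℂ × ℂ → ℂ) (z : ℂ × ℂ) : ℂ := ∫ θ, G (torusPoint θ * z) ∂torusMeasure

/-- The part of the domain off the coordinate axes. -/
def puncturedDomain (γ : ℝ) : Set (ℂ × ℂ) := {z | z ∈ domain γ ∧ z.1 ≠ 0}

@[fun_prop]
theorem continuous_torusPoint : Continuous torusPoint := by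
  have h : Continuous fun t : UnitAddCircle => (t.toCircle : ℂ) :=
    continuous_subtype_val.comp AddCircle.continuous_toCircle
  exact (h.comp continuous_fst).prodMk (h.comp continuous_snd)

@[simp]
theorem norm_torusPoint_mul_fst (θ : UnitAddCircle × UnitAddCircle) (z : ℂ × ℂ) :
    ‖(torusPoint θ * z).1‖ = ‖z.1‖ := by
  rw [torusPoint, Prod.fst_mul, norm_mul, Circle.norm_coe, one_mul]

@[simp]
theorem norm_torusPoint_mul_snd (θ : UnitAddCircle × UnitAddCircle) (z : ℂ × ℂ) :
    ‖(torusPoint θ * z).2‖ = ‖z.2‖ := by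
  rw [torusPoint, Prod.snd_mul, norm_mul, Circle.norm_coe, one_mul]

@[simp]
theorem torusPoint_mul_mem_domain {γ : ℝ} {θ : UnitAddCircle × UnitAddCircle} {z : ℂ × ℂ} :
    torusPoint θ * z ∈ domain γ ↔ z ∈ domain γ := by
  simp only [domain, mem_ofPred_eq, norm_torusPoint_mul_fst, norm_torusPoint_mul_snd]

theorem torusPoint_mul_mem_puncturedDomain {γ : ℝ} {θ : UnitAddCircle × UnitAddCircle}
    {z : ℂ × ℂ} : torusPoint θ * z ∈ puncturedDomain γ ↔ z ∈ puncturedDomain γ :=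
  torusPoint_mul_mem_domain.and <| not_congr <| by
    rw [← norm_eq_zero, norm_torusPoint_mul_fst, norm_eq_zero]

theorem measurePreserving_torusPoint_mul {γ : ℝ} (hγ : 0 < γ)
    (θ : UnitAddCircle × UnitAddCircle) :
    MeasurePreserving (torusPoint θ * ·) (vol γ) (vol γ) := by
  have h : MeasurePreserving (torusPoint θ * ·) (volume : Measure (ℂ × ℂ)) volume :=
    (rotation θ.1.toCircle).measurePreserving.prod (rotation θ.2.toCircle).measurePreserving
  have hinv : (torusPoint θ * ·) ⁻¹' domain γ = domain γ :=
    Set.ext fun z => torusPoint_mul_mem_domain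
  have hres := h.restrict_preimage (measurableSet_domain hγ)
  rwa [hinv] at hres

theorem measurePreserving_torusPoint_mul_uncurry {γ : ℝ} (hγ : 0 < γ) :
    MeasurePreserving
      (fun q : (UnitAddCircle × UnitAddCircle) × (ℂ × ℂ) => torusPoint q.1 * q.2)
      (torusMeasure.prod (vol γ)) (vol γ) := by
  have := isFiniteMeasure_vol hγ
  exact measurePreserving_snd.comp <|
    (MeasurePreserving.id torusMeasure).skew_product
      (g := fun θ z => torusPoint θ * z) (by fun_prop)
      (.of_forall fun θ => (measurePreserving_torusPoint_mul hγ θ).map_eq)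

theorem integral_eq_integral_torusMean {γ : ℝ} (hγ : 0 < γ) {F : ℂ × ℂ → ℂ}
    (hF : Integrable F (vol γ)) : ∫ z, F z ∂(vol γ) = ∫ z, torusMean F z ∂(vol γ) := by
  have := isFiniteMeasure_vol hγ
  have hmp := measurePreserving_torusPoint_mul_uncurry hγ
  have hprod := integral_prod_symm _ (hmp.integrable_comp_of_integrable hF)
  rw [← hmp.map_eq] at hF
  refine Eq.trans ?_ hprod
  conv_lhs => rw [← hmp.map_eq]
  exact integral_map hmp.measurable.aemeasurable hF.1

theorem lintegral_eq_lintegral_torus {γ : ℝ} (hγ : 0 < γ) {F : ℂ × ℂ → ℝ≥0∞}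
    (hF : AEMeasurable F (vol γ)) :
    ∫⁻ z, F z ∂(vol γ) = ∫⁻ z, (∫⁻ θ, F (torusPoint θ * z) ∂torusMeasure) ∂(vol γ) := by
  have := isFiniteMeasure_vol hγ
  have hmp := measurePreserving_torusPoint_mul_uncurry hγ
  have hprod := lintegral_prod_symm _ (hF.comp_quasiMeasurePreserving hmp.quasiMeasurePreserving)
  rw [← hmp.map_eq] at hF
  refine Eq.trans ?_ hprod
  conv_lhs => rw [← hmp.map_eq]
  exact lintegral_map' hF hmp.measurable.aemeasurable

theorem haarAddCircle_eq_volume : (AddCircle.haarAddCircle : Measure UnitAddCircle) = volume := by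
  rw [AddCircle.volume_eq_smul_haarAddCircle, ENNReal.ofReal_one, one_smul]

theorem integral_toCircle_eq_circleAverage (g : ℂ → ℂ) (ζ : ℂ) :
    ∫ θ : UnitAddCircle, g (θ.toCircle * ζ) ∂AddCircle.haarAddCircle =
      circleAverage g 0 ‖ζ‖ := by
  have hpt (x : ℝ) : g ((AddCircle.toCircle (x : UnitAddCircle) : ℂ) * ζ) =
      g (circleMap 0 ‖ζ‖ (2 * π * x + ζ.arg)) := by
    congr 1
    conv_lhs => rw [← Complex.norm_mul_exp_arg_mul_I ζ]
    rw [AddCircle.toCircle_apply_mk, Circle.coe_exp, circleMap, zero_add, mul_left_comm,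
      ← Complex.exp_add]
    push_cast
    ring_nf
  have hscale := intervalIntegral.integral_comp_mul_left (a := 0) (b := 1)
    (fun θ : ℝ => g (circleMap 0 ‖ζ‖ (θ + ζ.arg))) (c := 2 * π) (by positivity)
  rw [mul_zero, mul_one] at hscale
  rw [circleAverage_eq_integral_add ζ.arg, ← hscale, haarAddCircle_eq_volume,
    ← UnitAddCircle.intervalIntegral_preimage 0, zero_add]
  exact intervalIntegral.integral_congr fun x _ => hpt x

theorem circleAverage_eq_of_differentiable_on_annulus {g : ℂ → ℂ} {r R : ℝ} (hr : 0 < r)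
    (hrR : r ≤ R) (hg : ∀ z : ℂ, r ≤ ‖z‖ → ‖z‖ ≤ R → DifferentiableAt ℂ g z) :
    circleAverage g 0 r = circleAverage g 0 R := by
  have hd (z : ℂ) (h1 : r ≤ ‖z‖) (h2 : ‖z‖ ≤ R) :
      DifferentiableAt ℂ (fun z => (z - 0)⁻¹ • g z) z := by
    have hz : z - 0 ≠ 0 := by simpa using norm_pos_iff.mp (hr.trans_le h1)
    exact ((differentiableAt_id.sub_const (0 : ℂ)).inv hz).smul (hg z h1 h2)
  rw [circleAverage_eq_circleIntegral hr.ne', circleAverage_eq_circleIntegral (by linarith)]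
  congr 1
  refine (Complex.circleIntegral_eq_of_differentiable_on_annulus_off_countable hr hrR
    countable_empty ?_ ?_).symm
  · intro z hz
    exact (hd z (by simpa using hz.2) (by simpa using hz.1)).continuousAt.continuousWithinAt
  · rintro z ⟨⟨h1, h2⟩, -⟩
    exact hd z (by simpa using (not_le.mp (by simpa using h2)).le) (le_of_lt (by simpa using h1))

theorem integral_toCircle_mul_eq {g : ℂ → ℂ} {ζ ξ : ℂ} (h0 : ζ ≠ 0) (hle : ‖ζ‖ ≤ ‖ξ‖)
    (hg : ∀ z : ℂ, ‖ζ‖ ≤ ‖z‖ → ‖z‖ ≤ ‖ξ‖ → DifferentiableAt ℂ g z) :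
    ∫ θ : UnitAddCircle, g (θ.toCircle * ζ) ∂AddCircle.haarAddCircle =
      ∫ θ : UnitAddCircle, g (θ.toCircle * ξ) ∂AddCircle.haarAddCircle := by
  rw [integral_toCircle_eq_circleAverage, integral_toCircle_eq_circleAverage]
  exact circleAverage_eq_of_differentiable_on_annulus (norm_pos_iff.mpr h0) hle hg

section TorusMean

variable {γ : ℝ} {G : ℂ × ℂ → ℂ} {z w : ℂ × ℂ}

theorem mem_puncturedDomain_of_norm_le (hγ : 0 < γ) (hz : z ∈ puncturedDomain γ) (hw0 : w.1 ≠ 0)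
    (h1 : ‖w.1‖ ≤ ‖z.1‖) (h2 : ‖z.2‖ ≤ ‖w.2‖) (h3 : ‖w.2‖ < 1) : w ∈ puncturedDomain γ :=
  ⟨⟨(Real.rpow_le_rpow (norm_nonneg _) h1 hγ.le).trans_lt (hz.1.1.trans_le h2), h3⟩, hw0⟩

theorem continuous_comp_torusPoint_mul (hG : ContinuousOn G (puncturedDomain γ))
    (hz : z ∈ puncturedDomain γ) : Continuous fun θ => G (torusPoint θ * z) :=
  hG.comp_continuous (by fun_prop) fun _ => torusPoint_mul_mem_puncturedDomain.mpr hz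

theorem integrable_comp_torusPoint_mul (hG : ContinuousOn G (puncturedDomain γ))
    (hz : z ∈ puncturedDomain γ) : Integrable (fun θ => G (torusPoint θ * z)) torusMeasure :=
  (continuous_comp_torusPoint_mul hG hz).integrable_of_hasCompactSupport (.of_compactSpace _)

theorem isOpen_puncturedDomain (hγ : 0 < γ) : IsOpen (puncturedDomain γ) :=
  (isOpen_domain hγ).inter (isOpen_compl_singleton.preimage continuous_fst)

theorem torusMean_eq_of_norm_fst_le (hγ : 0 < γ) (hG : DifferentiableOn ℂ G (puncturedDomain γ))
    (hz : z ∈ puncturedDomain γ) {ζ : ℂ} (hζ : ζ ≠ 0) (hle : ‖ζ‖ ≤ ‖z.1‖) :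
    torusMean G (ζ, z.2) = torusMean G z := by
  have hz' : (ζ, z.2) ∈ puncturedDomain γ :=
    mem_puncturedDomain_of_norm_le hγ hz hζ hle le_rfl hz.1.2
  rw [torusMean, torusMean,
    integral_prod_symm _ (integrable_comp_torusPoint_mul hG.continuousOn hz'),
    integral_prod_symm _ (integrable_comp_torusPoint_mul hG.continuousOn hz)]
  congr 1 with θ
  refine integral_toCircle_mul_eq (g := fun u => G (u, θ.toCircle * z.2)) hζ hle fun u h1 h2 => ?_
  have hnorm : ‖(θ.toCircle : ℂ) * z.2‖ = ‖z.2‖ := by rw [norm_mul, Circle.norm_coe, one_mul]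
  have hmem : (u, (θ.toCircle : ℂ) * z.2) ∈ puncturedDomain γ :=
    mem_puncturedDomain_of_norm_le hγ hz (norm_pos_iff.mp ((norm_pos_iff.mpr hζ).trans_le h1))
      h2 hnorm.ge (hnorm.trans_lt hz.1.2)
  exact (hG.differentiableAt ((isOpen_puncturedDomain hγ).mem_nhds hmem)).comp u
    (differentiableAt_id.prodMk (differentiableAt_const _))

theorem torusMean_eq_of_norm_snd_le (hγ : 0 < γ) (hG : DifferentiableOn ℂ G (puncturedDomain γ))
    (hz : z ∈ puncturedDomain γ) {ζ : ℂ} (hζ : ‖ζ‖ < 1) (hle : ‖z.2‖ ≤ ‖ζ‖) :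
    torusMean G z = torusMean G (z.1, ζ) := by
  have hz' : (z.1, ζ) ∈ puncturedDomain γ :=
    mem_puncturedDomain_of_norm_le hγ hz hz.2 le_rfl hle hζ
  rw [torusMean, torusMean,
    integral_prod _ (integrable_comp_torusPoint_mul hG.continuousOn hz'),
    integral_prod _ (integrable_comp_torusPoint_mul hG.continuousOn hz)]
  congr 1 with θ
  refine integral_toCircle_mul_eq (g := fun v => G (θ.toCircle * z.1, v))
    (snd_ne_zero_of_mem_domain hz.1) hle fun v h1 h2 => ?_
  have hnorm : ‖(θ.toCircle : ℂ) * z.1‖ = ‖z.1‖ := by rw [norm_mul, Circle.norm_coe, one_mul]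
  have hmem : ((θ.toCircle : ℂ) * z.1, v) ∈ puncturedDomain γ :=
    mem_puncturedDomain_of_norm_le hγ hz (mul_ne_zero (Circle.coe_ne_zero _) hz.2) hnorm.le h1
      (h2.trans_lt hζ)
  exact (hG.differentiableAt ((isOpen_puncturedDomain hγ).mem_nhds hmem)).comp v
    ((differentiableAt_const _).prodMk differentiableAt_id)

theorem torusMean_eq (hγ : 0 < γ) (hG : DifferentiableOn ℂ G (puncturedDomain γ))
    (hz : z ∈ puncturedDomain γ) (hw : w ∈ puncturedDomain γ) : torusMean G z = torusMean G w := by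
  obtain ⟨a, ha0, haz, haw⟩ : ∃ a : ℂ, a ≠ 0 ∧ ‖a‖ ≤ ‖z.1‖ ∧ ‖a‖ ≤ ‖w.1‖ := by
    rcases le_total ‖z.1‖ ‖w.1‖ with h | h
    exacts [⟨z.1, hz.2, le_rfl, h⟩, ⟨w.1, hw.2, h, le_rfl⟩]
  obtain ⟨b, hb1, hbz, hbw⟩ : ∃ b : ℂ, ‖b‖ < 1 ∧ ‖z.2‖ ≤ ‖b‖ ∧ ‖w.2‖ ≤ ‖b‖ := by
    rcases le_total ‖z.2‖ ‖w.2‖ with h | h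
    exacts [⟨w.2, hw.1.2, h, le_rfl⟩, ⟨z.2, hz.1.2, le_rfl, h⟩]
  have key {v : ℂ × ℂ} (hv : v ∈ puncturedDomain γ) (h1 : ‖a‖ ≤ ‖v.1‖) (h2 : ‖v.2‖ ≤ ‖b‖) :
      torusMean G v = torusMean G (a, b) := by
    have hav : (a, v.2) ∈ puncturedDomain γ :=
      mem_puncturedDomain_of_norm_le hγ hv ha0 h1 le_rfl hv.1.2
    rw [← torusMean_eq_of_norm_fst_le hγ hG hv ha0 h1]
    exact torusMean_eq_of_norm_snd_le hγ hG hav hb1 h2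
  rw [key hz haz hbz, key hw haw hbw]

end TorusMean

/-! ### Laurent expansion -/

/-- The component of `h` at `z` along the character `α` of the torus; for a holomorphic `h` this is
the term of index `α` of its Laurent series. -/
def laurentTerm (h : ℂ × ℂ → ℂ) (α : ℤ × ℤ) (z : ℂ × ℂ) : ℂ :=
  ∫ θ, monomial (-α) (torusPoint θ) * h (torusPoint θ * z) ∂torusMeasure

theorem monomial_neg (α : ℤ × ℤ) (z : ℂ × ℂ) : monomial (-α) z = (monomial α z)⁻¹ := by
  simp only [monomial, Prod.fst_neg, Prod.snd_neg, zpow_neg, mul_inv]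

theorem norm_monomial_torusPoint (α : ℤ × ℤ) (θ : UnitAddCircle × UnitAddCircle) :
    ‖monomial α (torusPoint θ)‖ = 1 := by
  simp only [norm_monomial, torusPoint, Circle.norm_coe, one_zpow, mul_one]

theorem rpow_enorm_integral_le_lintegral {X E : Type*} [MeasurableSpace X] [NormedAddCommGroup E]
    [NormedSpace ℝ E] {μ : Measure X} [IsProbabilityMeasure μ] {g : X → E}
    (hg : AEStronglyMeasurable g μ) {s : ℝ} (hs : 1 ≤ s) :
    ‖∫ x, g x ∂μ‖ₑ ^ s ≤ ∫⁻ x, ‖g x‖ₑ ^ s ∂μ := by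
  have hs0 : 0 < s := by positivity
  have h := eLpNorm'_le_eLpNorm'_of_exponent_le one_pos hs μ hg
  simp only [eLpNorm', ENNReal.rpow_one, one_div, inv_one] at h
  exact (ENNReal.le_rpow_inv_iff hs0).mp ((enorm_integral_le_lintegral_enorm g).trans h)

section Laurent

variable {γ : ℝ} {p : ℝ≥0∞} {α : ℤ × ℤ} {h : ℂ × ℂ → ℂ} {z w : ℂ × ℂ}

theorem monomial_ne_zero (α : ℤ × ℤ) (hz : z ∈ puncturedDomain γ) : monomial α z ≠ 0 :=
  mul_ne_zero (zpow_ne_zero _ hz.2) (zpow_ne_zero _ (snd_ne_zero_of_mem_domain hz.1))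

theorem differentiableOn_monomial_puncturedDomain (γ : ℝ) (α : ℤ × ℤ) :
    DifferentiableOn ℂ (monomial α) (puncturedDomain γ) := fun _ hz =>
  ((differentiableAt_fst.zpow (.inl hz.2)).mul
    (differentiableAt_snd.zpow (.inl (snd_ne_zero_of_mem_domain hz.1)))).differentiableWithinAt

theorem ae_mem_puncturedDomain (hγ : 0 < γ) : ∀ᵐ z ∂(vol γ), z ∈ puncturedDomain γ := by
  have hfst : ∀ᵐ z : ℂ × ℂ ∂volume, z.1 ≠ 0 :=
    Measure.quasiMeasurePreserving_fst.ae (Measure.ae_ne volume (0 : ℂ))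
  exact (ae_restrict_mem (measurableSet_domain hγ)).and (ae_restrict_of_ae hfst)

theorem torusMean_mul_monomial_neg (h : ℂ × ℂ → ℂ) (α : ℤ × ℤ) (z : ℂ × ℂ) :
    torusMean (fun w => monomial (-α) w * h w) z = laurentTerm h α z * monomial (-α) z := by
  rw [torusMean, laurentTerm, ← integral_mul_const]
  congr 1 with θ
  rw [monomial_mul]
  ring

theorem laurentTerm_eq_mul_monomial (hγ : 0 < γ) (hh : DifferentiableOn ℂ h (domain γ))
    (α : ℤ × ℤ) (hz : z ∈ puncturedDomain γ) (hw : w ∈ puncturedDomain γ) :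
    laurentTerm h α w = laurentTerm h α z * monomial (-α) z * monomial α w := by
  have hdiff : DifferentiableOn ℂ (fun w => monomial (-α) w * h w) (puncturedDomain γ) :=
    (differentiableOn_monomial_puncturedDomain γ (-α)).mul (hh.mono fun w hw => hw.1)
  rw [← torusMean_mul_monomial_neg, torusMean_eq hγ hdiff hz hw, torusMean_mul_monomial_neg,
    monomial_neg, inv_mul_cancel_right₀ (monomial_ne_zero α hw)]

theorem torusMean_conj_monomial_mul (h : ℂ × ℂ → ℂ) (α : ℤ × ℤ) (z : ℂ × ℂ) :
    torusMean (fun w => conj (monomial α w) * h w) z = conj (monomial α z) * laurentTerm h α z := by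
  rw [torusMean, laurentTerm, ← integral_const_mul]
  congr 1 with θ
  rw [monomial_mul, map_mul, monomial_neg, Complex.inv_eq_conj (norm_monomial_torusPoint α θ)]
  ring

theorem laurentTerm_eq_monomialCoeff_mul (hγ : 0 < γ) (hα : α ∈ allowable γ 2)
    (hh : MemBergman γ 2 h) (hz : z ∈ puncturedDomain γ) :
    laurentTerm h α z = monomial α z * monomialCoeff γ h α := by
  have hint : ∫ w, conj (monomial α w) * h w ∂(vol γ) =
      ∫ w, ((‖monomial α w‖ ^ 2 : ℝ) : ℂ) * (laurentTerm h α z * monomial (-α) z) ∂(vol γ) := by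
    rw [integral_eq_integral_torusMean hγ (integrable_conj_monomial_mul hα hh.2)]
    refine integral_congr_ae ?_
    filter_upwards [ae_mem_puncturedDomain hγ] with w hw
    rw [torusMean_conj_monomial_mul, laurentTerm_eq_mul_monomial hγ hh.1 α hz hw,
      ← Complex.normSq_eq_norm_sq, Complex.normSq_eq_conj_mul_self]
    ring
  have hN : (monomialNormSq γ α : ℂ) ≠ 0 := by exact_mod_cast (monomialNormSq_pos hγ hα).ne'
  rw [integral_mul_const, integral_complex_ofReal] at hint
  have hcoeff : monomialCoeff γ h α = laurentTerm h α z * monomial (-α) z :=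
    (div_eq_iff hN).mpr (hint.trans (mul_comm _ _))
  rw [hcoeff, monomial_neg, mul_left_comm, mul_inv_cancel₀ (monomial_ne_zero α hz), mul_one]

theorem lintegral_enorm_laurentTerm_rpow_le (hγ : 0 < γ) (hh : DifferentiableOn ℂ h (domain γ))
    (α : ℤ × ℤ) {s : ℝ} (hs : 1 ≤ s) :
    ∫⁻ z, ‖laurentTerm h α z‖ₑ ^ s ∂(vol γ) ≤ ∫⁻ z, ‖h z‖ₑ ^ s ∂(vol γ) := by
  have hmeas : AEMeasurable (fun z => ‖h z‖ₑ ^ s) (vol γ) :=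
    (hh.continuousOn.aestronglyMeasurable (measurableSet_domain hγ)).enorm.pow_const s
  rw [lintegral_eq_lintegral_torus hγ hmeas]
  refine lintegral_mono_ae ?_
  filter_upwards [ae_mem_puncturedDomain hγ] with z hz
  have hcont := continuous_comp_torusPoint_mul (hh.continuousOn.mono fun w hw => hw.1) hz
  refine (rpow_enorm_integral_le_lintegral
    (((measurable_monomial (-α)).comp continuous_torusPoint.measurable).aestronglyMeasurable.mul
      hcont.aestronglyMeasurable) hs).trans_eq ?_
  refine lintegral_congr fun θ => ?_
  rw [Pi.mul_apply, enorm_mul, Function.comp_apply, ← ofReal_norm (monomial _ _),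
    norm_monomial_torusPoint, ENNReal.ofReal_one, one_mul]

theorem laurentTerm_eq_zero (hγ : 0 < γ) (hp : 2 ≤ p) (hp' : p ≠ ∞) (hh : MemBergman γ p h)
    (hα : α ∉ allowable γ p) (hz : z ∈ puncturedDomain γ) : laurentTerm h α z = 0 := by
  have hp0 : p ≠ 0 := (two_pos.trans_le hp).ne'
  have hpr : 1 ≤ p.toReal := ENNReal.toReal_mono hp' (one_le_two.trans hp)
  by_contra hne
  set c := laurentTerm h α z * monomial (-α) z with hc
  have hc0 : c ≠ 0 := mul_ne_zero hne (monomial_ne_zero _ hz)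
  have htop : ∫⁻ w in domain γ, ‖monomial α w‖ₑ ^ p.toReal = ∞ :=
    not_ne_iff.mp fun H => hα ((mem_allowable_iff_lintegral_ne_top hγ hp hp').mpr H)
  have hfin : ∫⁻ w, ‖laurentTerm h α w‖ₑ ^ p.toReal ∂(vol γ) ≠ ∞ :=
    ((lintegral_enorm_laurentTerm_rpow_le hγ hh.1 α hpr).trans_lt
      ((eLpNorm_lt_top_iff_lintegral_rpow_enorm_lt_top hp0 hp').mp hh.2.2)).ne
  refine hfin ?_
  calc ∫⁻ w, ‖laurentTerm h α w‖ₑ ^ p.toReal ∂(vol γ)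
      = ∫⁻ w, ‖c‖ₑ ^ p.toReal * ‖monomial α w‖ₑ ^ p.toReal ∂(vol γ) := by
        refine lintegral_congr_ae ?_
        filter_upwards [ae_mem_puncturedDomain hγ] with w hw
        rw [laurentTerm_eq_mul_monomial hγ hh.1 α hz hw, ← hc, enorm_mul,
          ENNReal.mul_rpow_of_nonneg _ _ (by positivity)]
    _ = ∞ := by
        rw [lintegral_const_mul _ (by fun_prop), vol, htop, ENNReal.mul_top]
        simp [hc0]

theorem mFourierCoeff_comp_torusPoint_mul (h : ℂ × ℂ → ℂ) (z : ℂ × ℂ) (k : Fin 2 → ℤ) :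
    UnitAddTorus.mFourierCoeff
      (fun x : UnitAddTorus (Fin 2) => h (torusPoint (x 0, x 1) * z)) k =
      laurentTerm h (k 0, k 1) z := by
  have hchar (x : UnitAddTorus (Fin 2)) :
      UnitAddTorus.mFourier (-k) x = monomial (-(k 0, k 1)) (torusPoint (x 0, x 1)) := by
    simp [UnitAddTorus.mFourier, fourier_apply, AddCircle.toCircle_neg, AddCircle.toCircle_zsmul,
      monomial, torusPoint, mul_comm]
  simp only [UnitAddTorus.mFourierCoeff, hchar]
  exact (measurePreserving_finTwoArrow AddCircle.haarAddCircle).integral_comp'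
    fun θ => monomial (-(k 0, k 1)) (torusPoint θ) * h (torusPoint θ * z)

theorem hasSum_laurentTerm (hh : ContinuousOn h (puncturedDomain γ)) (hz : z ∈ puncturedDomain γ)
    (hsum : Summable fun α => laurentTerm h α z) : HasSum (fun α => laurentTerm h α z) (h z) := by
  let f : C(UnitAddTorus (Fin 2), ℂ) := ⟨fun x => h (torusPoint (x 0, x 1) * z),
    (continuous_comp_torusPoint_mul hh hz).comp (by fun_prop)⟩
  have hcoeff : UnitAddTorus.mFourierCoeff f =
      (fun α => laurentTerm h α z) ∘ finTwoArrowEquiv ℤ :=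
    funext (mFourierCoeff_comp_torusPoint_mul h z)
  have hfourier := UnitAddTorus.hasSum_mFourier_series_apply_of_summable (f := f)
    (by rw [hcoeff]; exact (finTwoArrowEquiv ℤ).summable_iff.mpr hsum) 0
  have hf0 : f 0 = h z := congrArg h (by simp [torusPoint, Prod.ext_iff])
  rw [hcoeff, hf0] at hfourier
  refine (finTwoArrowEquiv ℤ).hasSum_iff.mp (hfourier.congr_fun fun k => ?_)
  simp [UnitAddTorus.mFourier]

/-! ### The reproducing property -/

theorem hasSum_laurentTerm_integralOp (hγ : 0 < γ) (hp : 2 ≤ p) (hp' : p ≠ ∞)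
    (hh : MemBergman γ p h) (hz : z ∈ puncturedDomain γ) :
    HasSum (fun α => laurentTerm h α z) (integralOp γ (subBergmanKernel γ p) h z) := by
  have := isFiniteMeasure_vol hγ
  have hh2 : MemBergman γ 2 h := ⟨hh.1, hh.2.mono_exponent hp⟩
  have hsupp : Function.support (fun α => laurentTerm h α z) ⊆ allowable γ p :=
    Function.support_subset_iff'.mpr fun α hα => laurentTerm_eq_zero hγ hp hp' hh hα hz
  refine (hasSum_subtype_iff_of_support_subset hsupp).mp
    ((hasSum_integralOp hγ hp hh2.2 hz.1).congr_fun fun α => ?_)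
  exact laurentTerm_eq_monomialCoeff_mul hγ (allowable_subset_two hγ hp α.2) hh2 hz

theorem integralOp_eq_self (hγ : 0 < γ) (hp : 2 ≤ p) (hp' : p ≠ ∞) (hh : MemBergman γ p h) :
    EqOn (integralOp γ (subBergmanKernel γ p) h) h (domain γ) := by
  have := isFiniteMeasure_vol hγ
  refine Measure.eqOn_open_of_ae_eq (μ := volume) ?_ (isOpen_domain hγ)
    (differentiableOn_integralOp hγ hp (hh.2.mono_exponent hp)).continuousOn hh.1.continuousOn
  filter_upwards [ae_mem_puncturedDomain hγ] with z hz
  have hsum := hasSum_laurentTerm_integralOp hγ hp hp' hh hz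
  exact hsum.unique
    (hasSum_laurentTerm (hh.1.continuousOn.mono fun w hw => hw.1) hz hsum.summable)

end Laurent

/-! ### The orthogonal projection -/

section Hilbert

variable {ι 𝕜 E : Type*} [RCLike 𝕜] [NormedAddCommGroup E] [InnerProductSpace 𝕜 E]

theorem hasSum_starProjection_closure_span {v : ι → E}
    (hv : Pairwise fun i j => inner 𝕜 (v i) (v j) = 0) (hv0 : ∀ i, v i ≠ 0)
    [CompleteSpace (Submodule.span 𝕜 (range v)).topologicalClosure] (x : E) :
    HasSum (fun i => (inner 𝕜 (v i) x / (‖v i‖ : 𝕜) ^ 2) • v i)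
      ((Submodule.span 𝕜 (range v)).topologicalClosure.starProjection x) := by
  set U := (Submodule.span 𝕜 (range v)).topologicalClosure
  have hvU (i : ι) : v i ∈ U :=
    Submodule.le_topologicalClosure _ (Submodule.subset_span (mem_range_self i))
  let e (i : ι) : U := (‖v i‖⁻¹ : 𝕜) • ⟨v i, hvU i⟩
  have he : Orthonormal 𝕜 e := by
    refine ⟨fun i => ?_, fun i j hij => ?_⟩
    · simp [e, norm_smul, hv0 i]
    · simp [e, inner_smul_left, inner_smul_right, hv hij]
  have hspan : (Submodule.span 𝕜 (range e))ᗮ = ⊥ := by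
    refine (Submodule.eq_bot_iff _).mpr fun y hy => Subtype.ext ?_
    have hy' (i : ι) : inner 𝕜 (v i) (y : E) = 0 := by
      have h : inner 𝕜 (e i) y = 0 :=
        (Submodule.mem_orthogonal _ _).mp hy _ (Submodule.subset_span (mem_range_self i))
      simpa [e, inner_smul_left, hv0 i] using h
    have hle : Submodule.span 𝕜 (range v) ≤ (Submodule.span 𝕜 {(y : E)})ᗮ :=
      Submodule.span_le.mpr <| by
        rintro _ ⟨i, rfl⟩
        exact Submodule.mem_orthogonal_singleton_iff_inner_left.mpr (hy' i)
    have hyy := Submodule.topologicalClosure_minimal _ hle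
      (Submodule.isClosed_orthogonal _) y.2
    exact inner_self_eq_zero.mp (Submodule.mem_orthogonal_singleton_iff_inner_left.mp hyy)
  have hsum := ((HilbertBasis.mkOfOrthogonalEqBot he hspan).hasSum_orthogonalProjectionOnto
    x).map U.subtypeL U.subtypeL.continuous
  refine hsum.congr_fun fun i => ?_
  simp [e, inner_smul_left, smul_smul, div_eq_mul_inv, sq, mul_comm, mul_left_comm]

theorem enorm_sub_sq_eq_add_starProjection {U : Submodule 𝕜 E} [U.HasOrthogonalProjection]
    (x : E) {y : E} (hy : y ∈ U) :
    ‖x - y‖ₑ ^ 2 = ‖x - U.starProjection x‖ₑ ^ 2 + ‖U.starProjection x - y‖ₑ ^ 2 := by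
  have horth : inner 𝕜 (x - U.starProjection x) (U.starProjection x - y) = 0 :=
    U.starProjection_inner_eq_zero x _ (U.sub_mem (U.starProjection_apply_mem x) hy)
  have hpyth := norm_add_sq_eq_norm_sq_add_norm_sq_of_inner_eq_zero _ _ horth
  rw [sub_add_sub_cancel, ← sq, ← sq, ← sq] at hpyth
  simp only [← ofReal_norm, ← ENNReal.ofReal_pow (norm_nonneg _)]
  rw [hpyth, ENNReal.ofReal_add (by positivity) (by positivity)]

end Hilbert

section LpSums

variable {X E : Type*} [MeasurableSpace X] {μ : Measure X} [NormedAddCommGroup E] {p : ℝ≥0∞}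

theorem ae_eq_of_hasSum_Lp {ι : Type*} [Countable ι] [Fact (1 ≤ p)] {F : ι → Lp E p μ}
    {S : Lp E p μ} (hF : HasSum F S) {g : X → E} (hg : ∀ᵐ x ∂μ, HasSum (fun i => F i x) (g x)) :
    S =ᵐ[μ] g := by
  obtain ⟨t, ht, hae⟩ := (tendstoInMeasure_of_tendsto_Lp hF).exists_seq_tendsto_ae'
  have hsum : ∀ᵐ x ∂μ, ∀ k, (∑ i ∈ t k, F i : Lp E p μ) x = ∑ i ∈ t k, F i x :=
    ae_all_iff.mpr fun k => Lp.coeFn_fun_finsetSum _ _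
  filter_upwards [hae, hsum, hg] with x hx hxsum hgx
  exact tendsto_nhds_unique hx ((hgx.comp ht).congr fun k => (hxsum k).symm)

theorem eLpNorm_sub_eq_enorm_sub {F G : Lp E p μ} {f g : X → E} (hF : F =ᵐ[μ] f)
    (hG : G =ᵐ[μ] g) : eLpNorm (f - g) p μ = ‖F - G‖ₑ := by
  rw [Lp.enorm_def]
  exact eLpNorm_congr_ae ((hF.symm.sub hG.symm).trans (Lp.coeFn_sub F G).symm)

end LpSums

theorem integral_toCircle_zpow {k : ℤ} (hk : k ≠ 0) :
    ∫ t : UnitAddCircle, (t.toCircle : ℂ) ^ k ∂AddCircle.haarAddCircle = 0 := by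
  simpa only [fourier_apply, AddCircle.toCircle_zsmul, Circle.coe_zpow] using
    integral_eq_zero_of_add_right_eq_neg (μ := AddCircle.haarAddCircle)
      (fourier_add_half_inv_index (T := 1) hk one_pos)

theorem integral_monomial_torusPoint {α : ℤ × ℤ} (hα : α ≠ 0) :
    ∫ θ, monomial α (torusPoint θ) ∂torusMeasure = 0 := by
  refine (integral_prod_mul (fun t : UnitAddCircle => (t.toCircle : ℂ) ^ α.1)
    fun t : UnitAddCircle => (t.toCircle : ℂ) ^ α.2).trans ?_
  by_cases h : α.1 = 0
  · rw [integral_toCircle_zpow fun h2 => hα (Prod.ext h h2), mul_zero]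
  · rw [integral_toCircle_zpow h, zero_mul]

theorem laurentTerm_monomial_of_ne {α β : ℤ × ℤ} (hne : α ≠ β) (z : ℂ × ℂ) :
    laurentTerm (monomial β) α z = 0 := by
  have h (θ : UnitAddCircle × UnitAddCircle) :
      monomial (-α) (torusPoint θ) * monomial β (torusPoint θ * z) =
        monomial (β - α) (torusPoint θ) * monomial β z := by
    simp only [monomial, torusPoint, Prod.fst_mul, Prod.snd_mul, Prod.fst_neg, Prod.snd_neg,
      Prod.fst_sub, Prod.snd_sub, mul_zpow, zpow_sub₀ (Circle.coe_ne_zero _), zpow_neg]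
    ring
  simp only [laurentTerm, h]
  rw [integral_mul_const, integral_monomial_torusPoint (sub_ne_zero.mpr hne.symm), zero_mul]

section Projection

variable {γ : ℝ} {p : ℝ≥0∞} {α β : ℤ × ℤ} {f g h : ℂ × ℂ → ℂ}

/-- The monomial `e_α` as an element of `L^2`. -/
def monomialLp (hα : α ∈ allowable γ 2) : L2 γ := hα.2.toLp

theorem inner_monomialLp (hα : α ∈ allowable γ 2) (hf : MemLp f 2 (vol γ)) :
    inner ℂ (monomialLp hα) (hf.toLp f) = ∫ w, conj (monomial α w) * f w ∂(vol γ) := by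
  rw [L2.inner_def]
  refine integral_congr_ae ?_
  filter_upwards [hα.2.coeFn_toLp, hf.coeFn_toLp] with w hαw hfw
  rw [monomialLp, hαw, hfw, RCLike.inner_apply, mul_comm]

theorem norm_monomialLp_sq (hα : α ∈ allowable γ 2) :
    (‖monomialLp hα‖ : ℂ) ^ 2 = monomialNormSq γ α := by
  have hself := inner_monomialLp hα hα.2
  simp_rw [← Complex.normSq_eq_conj_mul_self, Complex.normSq_eq_norm_sq] at hself
  rw [integral_complex_ofReal] at hself
  exact (inner_self_eq_norm_sq_to_K _).symm.trans hself

theorem monomialLp_ne_zero (hγ : 0 < γ) (hα : α ∈ allowable γ 2) : monomialLp hα ≠ 0 := by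
  intro h0
  have hnorm := norm_monomialLp_sq hα
  rw [h0, norm_zero, Complex.ofReal_zero, zero_pow two_ne_zero] at hnorm
  exact (monomialNormSq_pos hγ hα).ne (by exact_mod_cast hnorm)

theorem inner_monomialLp_of_ne (hγ : 0 < γ) (hα : α ∈ allowable γ 2) (hβ : β ∈ allowable γ 2)
    (hne : α ≠ β) : inner ℂ (monomialLp hα) (monomialLp hβ) = 0 := by
  refine (inner_monomialLp hα hβ.2).trans ?_
  rw [integral_eq_integral_torusMean hγ (integrable_conj_monomial_mul hα hβ.2)]
  simp only [torusMean_conj_monomial_mul, laurentTerm_monomial_of_ne hne, mul_zero,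
    integral_zero]

/-- The closed span in `L^2` of the `L^p`-allowable monomials. -/
def monomialSpan (hγ : 0 < γ) (hp : 2 ≤ p) : Submodule ℂ (L2 γ) :=
  (Submodule.span ℂ (range fun α : allowable γ p =>
    monomialLp (allowable_subset_two hγ hp α.2))).topologicalClosure

instance (hγ : 0 < γ) (hp : 2 ≤ p) : CompleteSpace (monomialSpan hγ hp) :=
  (Submodule.isClosed_topologicalClosure _).completeSpace_coe

theorem starProjection_monomialSpan_ae_eq (hγ : 0 < γ) (hp : 2 ≤ p) (hf : MemLp f 2 (vol γ)) :
    (monomialSpan hγ hp).starProjection (hf.toLp f) =ᵐ[vol γ]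
      integralOp γ (subBergmanKernel γ p) f := by
  have hs := allowable_subset_two hγ hp
  have hsum := hasSum_starProjection_closure_span (𝕜 := ℂ)
    (fun (α β : allowable γ p) hne =>
      inner_monomialLp_of_ne hγ (hs α.2) (hs β.2) (Subtype.coe_ne_coe.mpr hne))
    (fun α => monomialLp_ne_zero hγ (hs α.2)) (hf.toLp f)
  refine ae_eq_of_hasSum_Lp hsum ?_
  have hcoe : ∀ᵐ z ∂(vol γ), ∀ α : allowable γ p, monomialLp (hs α.2) z = monomial α z :=
    ae_all_iff.mpr fun α => (hs α.2).2.coeFn_toLp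
  have hsmul : ∀ᵐ z ∂(vol γ), ∀ α : allowable γ p,
      (monomialCoeff γ f α • monomialLp (hs α.2) : L2 γ) z =
        monomialCoeff γ f α • monomialLp (hs α.2) z :=
    ae_all_iff.mpr fun α => Lp.coeFn_smul _ _
  filter_upwards [hcoe, hsmul, ae_restrict_mem (measurableSet_domain hγ)] with z hzcoe hzsmul hz
  refine (hasSum_integralOp hγ hp hf hz).congr_fun fun α => ?_
  rw [RCLike.ofReal_eq_complex_ofReal, norm_monomialLp_sq, inner_monomialLp]
  exact (hzsmul α).trans (by rw [hzcoe, smul_eq_mul, mul_comm])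

theorem closedBergmanSubspace_eq_monomialSpan (hγ : 0 < γ) (hp : 2 ≤ p) (hp' : p ≠ ∞) :
    closedBergmanSubspace γ p = monomialSpan hγ hp := by
  have := isFiniteMeasure_vol hγ
  apply le_antisymm
  · refine Submodule.topologicalClosure_minimal _ ?_ (Submodule.isClosed_topologicalClosure _)
    rintro F ⟨h, hh, hF⟩
    have hh2 : MemLp h 2 (vol γ) := hh.2.mono_exponent hp
    have hFh : hh2.toLp h = F := Lp.ext (hh2.coeFn_toLp.trans hF.symm)
    refine Submodule.starProjection_eq_self_iff.mp (Lp.ext ?_)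
    rw [← hFh]
    refine (starProjection_monomialSpan_ae_eq hγ hp hh2).trans (.trans ?_ hh2.coeFn_toLp.symm)
    exact (ae_restrict_mem (measurableSet_domain hγ)).mono
      fun z hz => integralOp_eq_self hγ hp hp' hh hz
  · refine Submodule.topologicalClosure_mono (Submodule.span_le.mpr ?_)
    rintro _ ⟨α, rfl⟩
    exact ⟨monomial α, α.2, MemLp.coeFn_toLp _⟩

theorem subBergmanProjection_ae_eq (hγ : 0 < γ) (hp : 2 ≤ p) (hp' : p ≠ ∞)
    (hf : MemLp f 2 (vol γ)) :
    subBergmanProjection γ p (hf.toLp f) =ᵐ[vol γ]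
      integralOp γ (subBergmanKernel γ p) f := by
  simp only [subBergmanProjection, closedBergmanSubspace_eq_monomialSpan hγ hp hp']
  exact starProjection_monomialSpan_ae_eq hγ hp hf

theorem isRepresentingKernel_subBergmanKernel (hγ : 0 < γ) (hp : 2 ≤ p) (hp' : p ≠ ∞) :
    IsRepresentingKernel γ (subBergmanKernel γ p) (subBergmanProjection γ p) := fun _ hf =>
  ⟨fun _ hz => integrableOn_subBergmanKernel_mul hγ hp hf hz,
    differentiableOn_integralOp hγ hp hf, subBergmanProjection_ae_eq hγ hp hp' hf⟩

theorem isClosed_bergmanSubspace (hγ : 0 < γ) : IsClosed (bergmanSubspace γ 2 : Set (L2 γ)) := by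
  refine isClosed_of_closure_subset fun F hF => ?_
  have hfix : subBergmanProjection γ 2 F = F := Submodule.starProjection_eq_self_iff.mpr hF
  have hF2 : MemLp F 2 (vol γ) := Lp.memLp F
  have hae := subBergmanProjection_ae_eq hγ le_rfl ENNReal.ofNat_ne_top hF2
  rw [Lp.toLp_coeFn, hfix] at hae
  exact ⟨_, ⟨differentiableOn_integralOp hγ le_rfl hF2, (memLp_congr_ae hae).mp hF2⟩, hae⟩

theorem eLpNorm_sub_sq_eq_add_integralOp (hγ : 0 < γ) (hp : 2 ≤ p) (hp' : p ≠ ∞)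
    (hg : MemLp g 2 (vol γ)) (hh : MemBergman γ p h) :
    eLpNorm (g - h) 2 (vol γ) ^ 2 =
      eLpNorm (g - integralOp γ (subBergmanKernel γ p) g) 2 (vol γ) ^ 2 +
        eLpNorm (integralOp γ (subBergmanKernel γ p) g - h) 2 (vol γ) ^ 2 := by
  have := isFiniteMeasure_vol hγ
  have hh2 : MemLp h 2 (vol γ) := hh.2.mono_exponent hp
  have hmem : hh2.toLp h ∈ closedBergmanSubspace γ p :=
    Submodule.le_topologicalClosure _ ⟨h, hh, hh2.coeFn_toLp⟩
  have hae := subBergmanProjection_ae_eq hγ hp hp' hg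
  rw [eLpNorm_sub_eq_enorm_sub hg.coeFn_toLp hh2.coeFn_toLp,
    eLpNorm_sub_eq_enorm_sub hg.coeFn_toLp hae, eLpNorm_sub_eq_enorm_sub hae hh2.coeFn_toLp]
  exact enorm_sub_sq_eq_add_starProjection _ hmem

theorem eLpNorm_sub_integralOp_le (hγ : 0 < γ) (hp : 2 ≤ p) (hp' : p ≠ ∞)
    (hg : MemLp g 2 (vol γ)) (hh : MemBergman γ p h) :
    eLpNorm (g - integralOp γ (subBergmanKernel γ p) g) 2 (vol γ) ≤
      eLpNorm (g - h) 2 (vol γ) :=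
  (ENNReal.pow_le_pow_left_iff two_ne_zero).mp <|
    le_self_add.trans_eq (eLpNorm_sub_sq_eq_add_integralOp hγ hp hp' hg hh).symm

theorem eqOn_integralOp_of_eLpNorm_sub_eq (hγ : 0 < γ) (hp : 2 ≤ p) (hp' : p ≠ ∞)
    (hg : MemLp g 2 (vol γ)) (hh : MemBergman γ p h)
    (heq : eLpNorm (g - h) 2 (vol γ) =
      eLpNorm (g - integralOp γ (subBergmanKernel γ p) g) 2 (vol γ)) :
    EqOn h (integralOp γ (subBergmanKernel γ p) g) (domain γ) := by
  have := isFiniteMeasure_vol hγ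
  have hpyth := eLpNorm_sub_sq_eq_add_integralOp hγ hp hp' hg hh
  have hfin : eLpNorm (g - h) 2 (vol γ) ^ 2 ≠ ∞ :=
    ENNReal.pow_ne_top (hg.sub (hh.2.mono_exponent hp)).2.ne
  rw [← heq] at hpyth
  have hzero := pow_eq_zero_iff two_ne_zero |>.mp <|
    (ENNReal.add_right_inj hfin).mp ((add_zero _).trans hpyth).symm
  have hdiff := differentiableOn_integralOp hγ hp hg
  have hmeas : AEStronglyMeasurable (integralOp γ (subBergmanKernel γ p) g - h) (vol γ) :=
    (hdiff.sub hh.1).continuousOn.aestronglyMeasurable (measurableSet_domain hγ)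
  have hae := (eLpNorm_eq_zero_iff hmeas two_ne_zero).mp hzero
  exact Measure.eqOn_open_of_ae_eq (Filter.eventuallyEq_iff_sub.mpr hae).symm
    (isOpen_domain hγ) hh.1.continuousOn hdiff.continuousOn

end Projection

/-! ### Pointwise bound of the kernel -/

section LinearMulGeometric

variable {u : ℂ}

theorem hasSum_linear_mul_geometric (hu : ‖u‖ < 1) (a d : ℂ) :
    HasSum (fun q : ℕ => (a * q + d) * u ^ q) (a * (u / (1 - u) ^ 2) + d * (1 - u)⁻¹) :=
  (((hasSum_coe_mul_geometric_of_norm_lt_one hu).mul_left a).add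
    ((hasSum_geometric_of_norm_lt_one hu).mul_left d)).congr_fun fun q => by ring

theorem summable_norm_linear_mul_geometric (hu : ‖u‖ < 1) (a d : ℂ) :
    Summable fun q : ℕ => ‖(a * q + d) * u ^ q‖ := by
  have hu' : ‖(‖u‖ : ℝ)‖ < 1 := by rwa [norm_norm]
  refine Summable.of_nonneg_of_le (fun q => norm_nonneg _) (fun q => ?_)
    (((hasSum_coe_mul_geometric_of_norm_lt_one hu').summable.mul_left ‖a‖).add
      ((hasSum_geometric_of_norm_lt_one hu').summable.mul_left ‖d‖))
  rw [norm_mul, norm_pow, ← mul_assoc, ← add_mul]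
  gcongr
  exact (norm_add_le _ _).trans_eq (by rw [norm_mul, Complex.norm_natCast])

theorem norm_tsum_linear_mul_geometric_le (hu : ‖u‖ < 1) (a d : ℂ) :
    ‖∑' q : ℕ, (a * q + d) * u ^ q‖ ≤ (‖a‖ + 2 * ‖d‖) * (‖1 - u‖ ^ 2)⁻¹ := by
  have hne : 1 - u ≠ 0 := sub_ne_zero.mpr fun h => by simp [← h] at hu
  have hsum : a * (u / (1 - u) ^ 2) + d * (1 - u)⁻¹ = (a * u + d * (1 - u)) / (1 - u) ^ 2 := by
    field_simp
  rw [(hasSum_linear_mul_geometric hu a d).tsum_eq, hsum, norm_div, norm_pow, div_eq_mul_inv]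
  gcongr
  have hle : ‖1 - u‖ ≤ 2 := (norm_sub_le _ _).trans (by rw [norm_one]; linarith)
  calc ‖a * u + d * (1 - u)‖ ≤ ‖a‖ * ‖u‖ + ‖d‖ * ‖1 - u‖ :=
        (norm_add_le _ _).trans_eq (by rw [norm_mul, norm_mul])
    _ ≤ ‖a‖ * 1 + ‖d‖ * 2 := by gcongr
    _ = _ := by ring

end LinearMulGeometric

/-- The least `j` with `n r + m j > -τ`. -/
def leastExponent (m n : ℕ) (τ : ℝ) (r : ℕ) : ℤ := ⌊(-τ - n * r) / m⌋ + 1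

/-- The multi-index with first entry `m q + r` and `n α₁ + m α₂ = n r + m (j + l)`, where `j` is
the least exponent for the residue `r`. These enumerate the `α` with `α₁ ≥ 0` and
`n α₁ + m α₂ > -τ` in such a way that the kernel series splits into products of series in one
variable. -/
def gridIndex (m n : ℕ) (τ : ℝ) (k : Fin m × (ℕ × ℕ)) : ℤ × ℤ :=
  (m * k.2.1 + k.1, leastExponent m n τ k.1 + k.2.2 - n * k.2.1)

/-- The largest power of `‖z₂ w₂‖⁻¹` occurring in the kernel whose indices are the `α` with
`α₁ ≥ 0` and `n α₁ + m α₂ > -τ`, as bounded by means of the integrality of `n α₁ + m α₂`. -/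
def singularExponent (m : ℕ) (τ : ℝ) : ℝ := max 0 (-(⌊-τ⌋ + 1) / m)

/-- The function of `ζ = z * star w` which dominates the kernel. -/
def kernelMajorant (m n : ℕ) (c : ℝ) (ζ : ℂ × ℂ) : ℝ :=
  ‖ζ.2‖ ^ (-c) * (‖1 - ζ.1 ^ m / ζ.2 ^ n‖ ^ 2)⁻¹ * (‖1 - ζ.2‖ ^ 2)⁻¹

section Grid

variable {m n : ℕ} {τ : ℝ}

theorem leastExponent_le_iff (hm : 0 < m) {r : ℕ} {j : ℤ} :
    leastExponent m n τ r ≤ j ↔ -τ < (n * r + m * j : ℝ) := by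
  have hm' : (0 : ℝ) < m := by exact_mod_cast hm
  rw [leastExponent, Int.add_one_le_iff, Int.floor_lt, div_lt_iff₀ hm', sub_lt_iff_lt_add',
    mul_comm (j : ℝ)]

theorem gridIndex_injective (m n : ℕ) (τ : ℝ) : Function.Injective (gridIndex m n τ) := by
  rintro ⟨r, q, l⟩ ⟨r', q', l'⟩ h
  simp only [gridIndex, Prod.mk.injEq] at h
  obtain ⟨hfst, hsnd⟩ := h
  have hdiv : m * q + r = m * q' + (r' : ℕ) := by exact_mod_cast hfst
  have hr : (r : ℕ) = r' := by
    simpa [Nat.mod_eq_of_lt r.2, Nat.mod_eq_of_lt r'.2] using congrArg (· % m) hdiv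
  rw [hr] at hdiv hsnd
  have hq : q = q' := Nat.eq_of_mul_eq_mul_left r.pos (Nat.add_right_cancel hdiv)
  rw [hq] at hsnd
  have hl : l = l' := by omega
  exact Prod.ext (Fin.ext hr) (Prod.ext hq hl)

theorem range_gridIndex (hm : 0 < m) :
    range (gridIndex m n τ) = {α | 0 ≤ α.1 ∧ -τ < (n * α.1 + m * α.2 : ℝ)} := by
  ext ⟨i, j⟩
  constructor
  · rintro ⟨⟨r, q, l⟩, h⟩
    simp only [gridIndex, Prod.mk.injEq] at h
    obtain ⟨rfl, rfl⟩ := h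
    refine ⟨by positivity, ?_⟩
    refine ((leastExponent_le_iff (n := n) (τ := τ) (r := r) hm).mp
      (le_add_of_nonneg_right (Int.natCast_nonneg l))).trans_eq ?_
    push_cast
    ring
  · rintro ⟨hi, h⟩
    obtain ⟨k, rfl⟩ := Int.eq_ofNat_of_zero_le hi
    obtain ⟨q, r, hr, rfl⟩ : ∃ q r : ℕ, r < m ∧ k = m * q + r :=
      ⟨k / m, k % m, Nat.mod_lt k hm, (Nat.div_add_mod k m).symm⟩
    have hle : leastExponent m n τ r ≤ j + n * q := by
      refine (leastExponent_le_iff hm).mpr (h.trans_eq ?_)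
      push_cast
      ring
    obtain ⟨l, hl⟩ := Int.eq_ofNat_of_zero_le (sub_nonneg.mpr hle)
    refine ⟨(⟨r, hr⟩, q, l), ?_⟩
    simp only [gridIndex, Prod.mk.injEq]
    exact ⟨by push_cast; rfl, by linarith⟩

theorem monomial_gridIndex (τ : ℝ) (r : Fin m) (q l : ℕ) {ζ : ℂ × ℂ} (hζ : ζ.2 ≠ 0) :
    monomial (gridIndex m n τ (r, q, l)) ζ =
      ζ.1 ^ (r : ℕ) * ζ.2 ^ leastExponent m n τ r * ((ζ.1 ^ m / ζ.2 ^ n) ^ q * ζ.2 ^ l) := by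
  have hfst : ζ.1 ^ (m * q + r : ℤ) = (ζ.1 ^ m) ^ q * ζ.1 ^ (r : ℕ) := by
    rw [← pow_mul, ← pow_add, ← zpow_natCast]
    push_cast
    rfl
  have hsnd : ζ.2 ^ (leastExponent m n τ r + l - n * q : ℤ) =
      ζ.2 ^ leastExponent m n τ r * ζ.2 ^ l / (ζ.2 ^ n) ^ q := by
    rw [zpow_sub₀ hζ, zpow_add₀ hζ, zpow_natCast, ← pow_mul, ← zpow_natCast ζ.2 (n * q)]
    push_cast
    rfl
  simp only [monomial, gridIndex, hfst, hsnd, div_pow]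
  ring

theorem singularExponent_mul_lt (hm : 0 < m) (hτ : 0 < τ) : singularExponent m τ * m < τ := by
  have hm' : (0 : ℝ) < m := by exact_mod_cast hm
  rw [singularExponent, ← lt_div_iff₀ hm']
  refine max_lt (by positivity) ?_
  gcongr
  linarith [Int.lt_floor_add_one (-τ)]

theorem neg_singularExponent_le (hm : 0 < m) (n : ℕ) (τ : ℝ) (r : ℕ) :
    -singularExponent m τ ≤ (n * r + m * leastExponent m n τ r : ℝ) / m := by
  have : (0 : ℝ) < m := by exact_mod_cast hm
  have hlt := (leastExponent_le_iff (n := n) (τ := τ) (r := r) hm).mp le_rfl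
  have hint : ⌊-τ⌋ + 1 ≤ n * (r : ℤ) + m * leastExponent m n τ r := by
    rw [Int.add_one_le_iff, Int.floor_lt]
    exact_mod_cast hlt
  have hreal : ((⌊-τ⌋ : ℝ) + 1) ≤ n * r + m * leastExponent m n τ r := by exact_mod_cast hint
  rw [neg_le, ← neg_div]
  refine le_trans ?_ (le_max_right _ _)
  gcongr

end Grid

section KernelBound

variable {m n : ℕ} {τ : ℝ} {p : ℝ≥0∞} {z w ζ : ℂ × ℂ}

theorem allowable_rational_eq (hm : 0 < m) (hn : 0 < n) (hp : 2 ≤ p) (hp' : p ≠ ∞) :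
    allowable ((m : ℝ) / n) p =
      {α | 0 ≤ α.1 ∧ -(2 * (m + n) / p.toReal) < (n * α.1 + m * α.2 : ℝ)} := by
  have : (0 : ℝ) < m := by exact_mod_cast hm
  have : (0 : ℝ) < n := by exact_mod_cast hn
  have hpr : 0 < p.toReal := ENNReal.toReal_pos (two_pos.trans_le hp).ne' hp'
  ext α
  rw [mem_allowable_iff (by positivity) hp hp']
  refine and_congr_right fun _ => ?_
  have hfactor : (α.1 * p.toReal + 2) / ((m : ℝ) / n) + α.2 * p.toReal + 2 =
      p.toReal / m * ((n * α.1 + m * α.2) - -(2 * (m + n) / p.toReal)) := by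
    field_simp
    ring
  rw [hfactor, mul_pos_iff_of_pos_left (by positivity), sub_pos]

theorem rpow_inv_div_pow (hm : 0 < m) (n : ℕ) {x : ℝ} (hx : 0 ≤ x) :
    (x ^ ((m : ℝ) / n)⁻¹) ^ m = x ^ n := by
  rw [← Real.rpow_natCast, ← Real.rpow_mul hx, inv_div, div_mul_cancel₀ _ (by positivity),
    Real.rpow_natCast]

theorem norm_pow_div_pow_lt_one (hm : 0 < m) (hn : 0 < n) (hζ : ζ ∈ domain ((m : ℝ) / n)) :
    ‖ζ.1 ^ m / ζ.2 ^ n‖ < 1 := by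
  have hγ : 0 < (m : ℝ) / n := by positivity
  have hζ2 : 0 < ‖ζ.2‖ := norm_pos_iff.mpr (snd_ne_zero_of_mem_domain hζ)
  rw [norm_div, norm_pow, norm_pow, div_lt_one (by positivity)]
  calc ‖ζ.1‖ ^ m < (‖ζ.2‖ ^ ((m : ℝ) / n)⁻¹) ^ m :=
        pow_lt_pow_left₀ ((mem_domain_iff hγ).mp hζ).2 (norm_nonneg _) hm.ne'
    _ = ‖ζ.2‖ ^ n := rpow_inv_div_pow hm n hζ2.le

theorem norm_pow_mul_zpow_leastExponent_le (hm : 0 < m) (hn : 0 < n) (τ : ℝ) (r : ℕ)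
    (hζ : ζ ∈ domain ((m : ℝ) / n)) :
    ‖ζ.1‖ ^ r * ‖ζ.2‖ ^ leastExponent m n τ r ≤ ‖ζ.2‖ ^ (-singularExponent m τ) := by
  have : (0 : ℝ) < m := by exact_mod_cast hm
  have hζ2 : 0 < ‖ζ.2‖ := norm_pos_iff.mpr (snd_ne_zero_of_mem_domain hζ)
  have hζ1 := ((mem_domain_iff (by positivity)).mp hζ).2.le
  calc ‖ζ.1‖ ^ r * ‖ζ.2‖ ^ leastExponent m n τ r
      ≤ (‖ζ.2‖ ^ ((m : ℝ) / n)⁻¹) ^ r * ‖ζ.2‖ ^ leastExponent m n τ r := by gcongr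
    _ = ‖ζ.2‖ ^ ((n * r + m * leastExponent m n τ r : ℝ) / m) := by
        rw [← Real.rpow_natCast, ← Real.rpow_mul hζ2.le, ← Real.rpow_intCast,
          ← Real.rpow_add hζ2]
        congr 1
        field_simp
    _ ≤ ‖ζ.2‖ ^ (-singularExponent m τ) :=
        Real.rpow_le_rpow_of_exponent_ge hζ2 hζ.2.le (neg_singularExponent_le hm n τ r)

theorem kernelTerm_eq_inv_mul_monomial (γ : ℝ) (z w : ℂ × ℂ) (α : ℤ × ℤ) :
    kernelTerm γ z w α = ((monomialNormSq γ α)⁻¹ : ℝ) * monomial α (z * star w) := by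
  have hstar : monomial α (star w) = conj (monomial α w) := by
    simp [monomial, map_zpow₀]
  rw [monomial_mul, hstar, kernelTerm, monomialNormSq, Complex.ofReal_inv]
  ring

theorem kernelTerm_gridIndex (hm : 0 < m) (hn : 0 < n) {k : Fin m × (ℕ × ℕ)}
    (hk : gridIndex m n τ k ∈ allowable ((m : ℝ) / n) 2) (hζ : (z * star w).2 ≠ 0) :
    kernelTerm ((m : ℝ) / n) z w (gridIndex m n τ k) =
      ((z * star w).1 ^ (k.1 : ℕ) * (z * star w).2 ^ leastExponent m n τ k.1 / (π ^ 2 * m)) *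
      ((m * k.2.1 + (k.1 + 1)) * ((z * star w).1 ^ m / (z * star w).2 ^ n) ^ k.2.1 *
        ((m * k.2.2 + (m * (leastExponent m n τ k.1 + 1) + n * (k.1 + 1))) *
          (z * star w).2 ^ k.2.2)) := by
  have hmC : (m : ℂ) ≠ 0 := by exact_mod_cast hm.ne'
  have : (n : ℂ) ≠ 0 := by exact_mod_cast hn.ne'
  have hπ : (π : ℂ) ≠ 0 := by exact_mod_cast Real.pi_ne_zero
  obtain ⟨r, q, l⟩ := k
  have hnorm : (((monomialNormSq ((m : ℝ) / n) (gridIndex m n τ (r, q, l)))⁻¹ : ℝ) : ℂ) =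
      (m * q + (r + 1)) * (m * l + (m * (leastExponent m n τ r + 1) + n * (r + 1))) /
        (π ^ 2 * m) := by
    rw [inv_monomialNormSq (by positivity) hk, excess]
    simp only [gridIndex]
    push_cast
    field_simp
    ring
  rw [kernelTerm_eq_inv_mul_monomial, hnorm, monomial_gridIndex τ r q l hζ]
  ring

theorem star_mem_domain {γ : ℝ} (hw : w ∈ domain γ) : star w ∈ domain γ := by
  simpa [domain] using hw

theorem subBergmanKernel_eq_sum (hm : 0 < m) (hn : 0 < n) (hp : 2 ≤ p)
    (hτ : range (gridIndex m n τ) = allowable ((m : ℝ) / n) p)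
    (hz : z ∈ domain ((m : ℝ) / n)) (hw : w ∈ domain ((m : ℝ) / n)) :
    subBergmanKernel ((m : ℝ) / n) p z w =
      ∑ r : Fin m, (z * star w).1 ^ (r : ℕ) * (z * star w).2 ^ leastExponent m n τ r / (π ^ 2 * m) *
        ((∑' q : ℕ, (m * q + (r + 1)) * ((z * star w).1 ^ m / (z * star w).2 ^ n) ^ q) *
          ∑' l : ℕ, (m * l + (m * (leastExponent m n τ r + 1) + n * (r + 1))) *
            (z * star w).2 ^ l) := by
  have hγ : 0 < (m : ℝ) / n := by positivity
  have hζ : z * star w ∈ domain ((m : ℝ) / n) := mul_mem_domain hγ hz (star_mem_domain hw)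
  let e := (Equiv.ofInjective _ (gridIndex_injective m n τ)).trans (Equiv.setCongr hτ)
  have hterm : ∀ k, kernelTerm ((m : ℝ) / n) z w (e k) = _ := fun k =>
    kernelTerm_gridIndex hm hn (allowable_subset_two hγ hp (e k).2) (snd_ne_zero_of_mem_domain hζ)
  have hsum : Summable fun k => kernelTerm ((m : ℝ) / n) z w (e k) :=
    e.summable_iff.mpr (summable_kernelTerm hγ hp hz hw)
  rw [subBergmanKernel, ← e.tsum_eq, hsum.tsum_prod, tsum_fintype]
  simp_rw [hterm]
  refine Finset.sum_congr rfl fun r _ => ?_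
  rw [tsum_mul_left, tsum_mul_tsum_of_summable_norm
    (summable_norm_linear_mul_geometric (norm_pow_div_pow_lt_one hm hn hζ) _ _)
    (summable_norm_linear_mul_geometric hζ.2 _ _)]

theorem exists_norm_subBergmanKernel_le (hm : 0 < m) (hn : 0 < n) (hp : 2 ≤ p) (hp' : p ≠ ∞) :
    ∃ C : ℝ≥0, ∀ z ∈ domain ((m : ℝ) / n), ∀ w ∈ domain ((m : ℝ) / n),
      ‖subBergmanKernel ((m : ℝ) / n) p z w‖ ≤
        C * kernelMajorant m n (singularExponent m (2 * (m + n) / p.toReal)) (z * star w) := by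
  set τ := 2 * (m + n) / p.toReal
  set A : Fin m → ℝ≥0 := fun r => ‖(m : ℂ)‖₊ + 2 * ‖((r : ℕ) + 1 : ℂ)‖₊ with hA
  set B : Fin m → ℝ≥0 := fun r => ‖(m : ℂ)‖₊ +
    2 * ‖(m * (leastExponent m n τ r + 1) + n * ((r : ℕ) + 1) : ℂ)‖₊ with hB
  refine ⟨∑ r, A r * B r * ‖(π ^ 2 * m : ℂ)‖₊⁻¹, fun z hz w hw => ?_⟩
  have hζ : z * star w ∈ domain ((m : ℝ) / n) :=
    mul_mem_domain (by positivity) hz (star_mem_domain hw)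
  have hτ := (range_gridIndex hm).trans (allowable_rational_eq hm hn hp hp').symm
  rw [subBergmanKernel_eq_sum hm hn hp hτ hz hw, kernelMajorant]
  push_cast
  rw [Finset.sum_mul]
  refine (norm_sum_le _ _).trans (Finset.sum_le_sum fun r _ => ?_)
  rw [norm_mul, norm_mul, norm_div, norm_mul, norm_pow, norm_zpow]
  set ζ := z * star w
  calc _ ≤ ‖ζ.2‖ ^ (-singularExponent m τ) / ‖(π ^ 2 * m : ℂ)‖ *
        ((A r * (‖1 - ζ.1 ^ m / ζ.2 ^ n‖ ^ 2)⁻¹) * (B r * (‖1 - ζ.2‖ ^ 2)⁻¹)) := by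
        gcongr
        · exact norm_pow_mul_zpow_leastExponent_le hm hn τ r hζ
        · exact norm_tsum_linear_mul_geometric_le (norm_pow_div_pow_lt_one hm hn hζ) _ _
        · exact norm_tsum_linear_mul_geometric_le hζ.2 _ _
    _ = _ := by
        simp only [hA, hB]
        push_cast
        ring

end KernelBound

/-! ### Schur's test -/

section Schur

variable {X Y : Type*} [MeasurableSpace X] [MeasurableSpace Y] {μ : Measure X} {ν : Measure Y}
  {p q : ℝ}

theorem rpow_lintegral_mul_le (hpq : p.HolderConjugate q) {Q k F : Y → ℝ≥0∞}
    (hQ : AEMeasurable Q ν) (hk : AEMeasurable k ν) (hF : AEMeasurable F ν)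
    (hk0 : ∀ᵐ y ∂ν, k y ≠ 0) (hk1 : ∀ᵐ y ∂ν, k y ≠ ∞) :
    (∫⁻ y, Q y * F y ∂ν) ^ p ≤
      (∫⁻ y, Q y * k y ^ q ∂ν) ^ (p / q) * ∫⁻ y, Q y * (F y / k y) ^ p ∂ν := by
  have hp := hpq.pos
  have hq := hpq.symm.pos
  have hsplit : ∫⁻ y, Q y * F y ∂ν =
      ∫⁻ y, Q y ^ (1 / q) * k y * (Q y ^ (1 / p) * (F y / k y)) ∂ν := by
    refine lintegral_congr_ae ?_
    filter_upwards [hk0, hk1] with y hy0 hy1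
    rw [mul_mul_mul_comm, ENNReal.mul_div_cancel hy0 hy1,
      ← ENNReal.rpow_add_of_nonneg _ _ (by positivity) (by positivity), one_div, one_div,
      hpq.symm.inv_add_inv_eq_one, ENNReal.rpow_one]
  have hpow {r : ℝ} (hr : 0 < r) (a b : ℝ≥0∞) : (a ^ (1 / r) * b) ^ r = a * b ^ r := by
    rw [ENNReal.mul_rpow_of_nonneg _ _ hr.le, ← ENNReal.rpow_mul, one_div_mul_cancel hr.ne',
      ENNReal.rpow_one]
  have hholder := ENNReal.lintegral_mul_le_Lp_mul_Lq ν hpq.symm ((hQ.pow_const (1 / q)).mul hk)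
    ((hQ.pow_const (1 / p)).mul (hF.div hk))
  simp only [Pi.mul_apply, Pi.div_apply, hpow hp, hpow hq] at hholder
  calc (∫⁻ y, Q y * F y ∂ν) ^ p
      ≤ ((∫⁻ y, Q y * k y ^ q ∂ν) ^ (1 / q) *
          (∫⁻ y, Q y * (F y / k y) ^ p ∂ν) ^ (1 / p)) ^ p := by
        rw [hsplit]
        gcongr
    _ = _ := by
        rw [mul_comm, hpow hp, ← ENNReal.rpow_mul, one_div_mul_eq_div, mul_comm]

theorem rpow_lintegral_mul_le_of_schur (hpq : p.HolderConjugate q) {Q k F : Y → ℝ≥0∞} {A H : ℝ≥0∞}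
    (hQ : Measurable Q) (hk : Measurable k) (hF : AEMeasurable F ν) (hk0 : ∀ᵐ y ∂ν, k y ≠ 0)
    (hk1 : ∀ᵐ y ∂ν, k y ≠ ∞) (hQk : ∫⁻ y, Q y * k y ^ q ∂ν ≤ A * H ^ q) :
    (∫⁻ y, Q y * F y ∂ν) ^ p ≤ A ^ (p / q) * ∫⁻ y, Q y * H ^ p * (F y / k y) ^ p ∂ν := by
  have hp := hpq.pos
  have hq := hpq.symm.pos
  have hmeas : AEMeasurable (fun y => Q y * (F y / k y) ^ p) ν :=
    hQ.aemeasurable.mul ((hF.div hk.aemeasurable).pow_const p)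
  calc (∫⁻ y, Q y * F y ∂ν) ^ p
      ≤ (A * H ^ q) ^ (p / q) * ∫⁻ y, Q y * (F y / k y) ^ p ∂ν := by
        refine (rpow_lintegral_mul_le hpq hQ.aemeasurable hk.aemeasurable hF hk0 hk1).trans ?_
        gcongr
    _ = A ^ (p / q) * ∫⁻ y, H ^ p * (Q y * (F y / k y) ^ p) ∂ν := by
        rw [ENNReal.mul_rpow_of_nonneg _ _ (by positivity), ← ENNReal.rpow_mul,
          mul_div_cancel₀ _ hq.ne', mul_assoc, lintegral_const_mul'' _ hmeas]
    _ = _ := by simp_rw [← mul_assoc, mul_comm (H ^ p)]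

theorem lintegral_rpow_lintegral_mul_le_of_schur [SFinite μ] [SFinite ν] (hpq : p.HolderConjugate q)
    {Q : X → Y → ℝ≥0∞} {h : X → ℝ≥0∞} {k F : Y → ℝ≥0∞} {A B : ℝ≥0}
    (hQ : Measurable (Function.uncurry Q)) (hh : Measurable h) (hk : Measurable k)
    (hF : AEMeasurable F ν) (hk0 : ∀ᵐ y ∂ν, k y ≠ 0) (hk1 : ∀ᵐ y ∂ν, k y ≠ ∞)
    (hQk : ∀ᵐ x ∂μ, ∫⁻ y, Q x y * k y ^ q ∂ν ≤ A * h x ^ q)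
    (hQh : ∀ᵐ y ∂ν, ∫⁻ x, Q x y * h x ^ p ∂μ ≤ B * k y ^ p) :
    ∫⁻ x, (∫⁻ y, Q x y * F y ∂ν) ^ p ∂μ ≤ (A : ℝ≥0∞) ^ (p / q) * B * ∫⁻ y, F y ^ p ∂ν := by
  have hp := hpq.pos
  have hq := hpq.symm.pos
  have hmeas : AEMeasurable (Function.uncurry fun x y => Q x y * h x ^ p * (F y / k y) ^ p)
      (μ.prod ν) :=
    (hQ.aemeasurable.mul ((hh.comp measurable_fst).pow_const p).aemeasurable).mul
      ((hF.div hk.aemeasurable).comp_snd.pow_const p)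
  calc ∫⁻ x, (∫⁻ y, Q x y * F y ∂ν) ^ p ∂μ
      ≤ ∫⁻ x, (A : ℝ≥0∞) ^ (p / q) * ∫⁻ y, Q x y * h x ^ p * (F y / k y) ^ p ∂ν ∂μ :=
        lintegral_mono_ae <| hQk.mono fun x hx =>
          rpow_lintegral_mul_le_of_schur hpq (hQ.comp measurable_prodMk_left) hk hF hk0 hk1 hx
    _ = (A : ℝ≥0∞) ^ (p / q) * ∫⁻ y, (∫⁻ x, Q x y * h x ^ p ∂μ) * (F y / k y) ^ p ∂ν := by
        rw [lintegral_const_mul' _ _ (by finiteness), lintegral_lintegral_swap hmeas]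
        congr! 3 with y
        exact lintegral_mul_const _ ((hQ.comp measurable_prodMk_right).mul (hh.pow_const p))
    _ ≤ (A : ℝ≥0∞) ^ (p / q) * ∫⁻ y, B * F y ^ p ∂ν := by
        gcongr 1
        refine lintegral_mono_ae ?_
        filter_upwards [hQh, hk0, hk1] with y hy hy0 hy1
        calc _ ≤ B * k y ^ p * (F y / k y) ^ p := by gcongr
          _ = B * F y ^ p := by
              rw [mul_assoc, ← ENNReal.mul_rpow_of_nonneg _ _ hp.le,
                ENNReal.mul_div_cancel hy0 hy1]
    _ = _ := by rw [lintegral_const_mul' _ _ ENNReal.coe_ne_top, mul_assoc]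

end Schur

/-! ### The Schur weights -/

/-- The distance of `w` from the axis of its fibre of the domain over `w.2`, a disc of radius
`‖w.2‖ ^ γ⁻¹`, relative to that radius. -/
def fiberRadius (γ : ℝ) (w : ℂ × ℂ) : ℝ := ‖w.1‖ / ‖w.2‖ ^ γ⁻¹

/-- The weights of Schur's test, singular of order `ε` at the two parts `‖w₁‖ ^ γ = ‖w₂‖` and
`‖w₂‖ = 1` of the boundary and of order `β` at the origin. -/
def schurWeight (γ ε β : ℝ) (w : ℂ × ℂ) : ℝ :=
  (1 - fiberRadius γ w) ^ (-ε) * (1 - ‖w.2‖) ^ (-ε) * ‖w.2‖ ^ (-β)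

section SchurWeight

variable {γ : ℝ} {z w : ℂ × ℂ}

theorem fiberRadius_nonneg (γ : ℝ) (w : ℂ × ℂ) : 0 ≤ fiberRadius γ w := by
  unfold fiberRadius
  positivity

theorem fiberRadius_lt_one (hγ : 0 < γ) (hw : w ∈ domain γ) : fiberRadius γ w < 1 :=
  (div_lt_one ((norm_nonneg _).trans_lt ((mem_domain_iff hγ).mp hw).2)).mpr
    ((mem_domain_iff hγ).mp hw).2

theorem fiberRadius_smul_mk (γ : ℝ) (u : ℂ) {v : ℂ} (hv : v ≠ 0) :
    fiberRadius γ (‖v‖ ^ γ⁻¹ • u, v) = ‖u‖ := by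
  have hv' : 0 < ‖v‖ ^ γ⁻¹ := by positivity
  rw [fiberRadius, norm_smul, Real.norm_of_nonneg hv'.le, mul_div_cancel_left₀ _ hv'.ne']

theorem schurWeight_pos (hγ : 0 < γ) (ε β : ℝ) (hw : w ∈ domain γ) : 0 < schurWeight γ ε β w :=
  mul_pos (mul_pos (Real.rpow_pos_of_pos (sub_pos.mpr (fiberRadius_lt_one hγ hw)) _)
    (Real.rpow_pos_of_pos (sub_pos.mpr hw.2) _))
    (Real.rpow_pos_of_pos (norm_pos_iff.mpr (snd_ne_zero_of_mem_domain hw)) _)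

theorem ofReal_schurWeight_rpow (hγ : 0 < γ) (ε β x : ℝ) (hw : w ∈ domain γ) :
    ENNReal.ofReal (schurWeight γ ε β w) ^ x =
      ENNReal.ofReal (schurWeight γ (ε * x) (β * x) w) := by
  have hfiber : 0 ≤ 1 - fiberRadius γ w := sub_nonneg.mpr (fiberRadius_lt_one hγ hw).le
  have hsnd : 0 ≤ 1 - ‖w.2‖ := sub_nonneg.mpr hw.2.le
  rw [ENNReal.ofReal_rpow_of_pos (schurWeight_pos hγ ε β hw)]
  simp only [schurWeight]
  rw [Real.mul_rpow (by positivity) (by positivity), Real.mul_rpow (by positivity) (by positivity),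
    ← Real.rpow_mul hfiber, ← Real.rpow_mul hsnd, ← Real.rpow_mul (norm_nonneg _), neg_mul, neg_mul]

@[fun_prop]
theorem measurable_schurWeight (γ ε β : ℝ) : Measurable (schurWeight γ ε β) := by
  unfold schurWeight fiberRadius
  fun_prop

end SchurWeight

section KernelMajorant

variable {m n : ℕ} {c ε β : ℝ} {z w : ℂ × ℂ}

theorem kernelMajorant_nonneg (m n : ℕ) (c : ℝ) (ζ : ℂ × ℂ) : 0 ≤ kernelMajorant m n c ζ := by
  unfold kernelMajorant
  positivity

theorem kernelMajorant_star (m n : ℕ) (c : ℝ) (ζ : ℂ × ℂ) :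
    kernelMajorant m n c (star ζ) = kernelMajorant m n c ζ := by
  have hconj (x : ℂ) : ‖1 - star x‖ = ‖1 - x‖ := by rw [← norm_star (1 - x), star_sub, star_one]
  simp only [kernelMajorant, Prod.fst_star, Prod.snd_star, ← star_pow, ← star_div₀, hconj,
    norm_star]

theorem kernelMajorant_mul_star_comm (m n : ℕ) (c : ℝ) (z w : ℂ × ℂ) :
    kernelMajorant m n c (z * star w) = kernelMajorant m n c (w * star z) := by
  rw [← kernelMajorant_star, star_mul, star_star]

@[fun_prop]
theorem measurable_kernelMajorant (m n : ℕ) (c : ℝ) : Measurable (kernelMajorant m n c) := by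
  unfold kernelMajorant
  fun_prop

theorem exists_kernelMajorant_mul_star_smul_mk (hm : 0 < m) (n : ℕ) (c : ℝ) (z : ℂ × ℂ) {v : ℂ}
    (hv : v ≠ 0) :
    ∃ a : ℂ, ‖a‖ = fiberRadius ((m : ℝ) / n) z ^ m ∧
      ∀ u, kernelMajorant m n c (z * star (‖v‖ ^ ((m : ℝ) / n)⁻¹ • u, v)) =
        ‖z.2‖ ^ (-c) * ‖v‖ ^ (-c) * (‖1 - a * u ^ m‖ ^ 2)⁻¹ * (‖1 - star z.2 * v‖ ^ 2)⁻¹ := by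
  have hpow (x : ℂ) : (‖x‖ ^ ((m : ℝ) / n)⁻¹) ^ m = ‖x‖ ^ n :=
    rpow_inv_div_pow hm n (norm_nonneg x)
  have hv' : ‖v‖ ≠ 0 := norm_ne_zero_iff.mpr hv
  refine ⟨star z.1 ^ m / star z.2 ^ n * (‖v‖ ^ n / v ^ n), ?_, fun u => ?_⟩
  · rw [fiberRadius, div_pow, hpow]
    simp [hv']
  · rw [← kernelMajorant_star, kernelMajorant]
    have hfst : (star z.1 * (‖v‖ ^ ((m : ℝ) / n)⁻¹ • u)) ^ m / (star z.2 * v) ^ n =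
        star z.1 ^ m / star z.2 ^ n * (‖v‖ ^ n / v ^ n) * u ^ m := by
      rw [Complex.real_smul, mul_pow, mul_pow, mul_pow, ← Complex.ofReal_pow, hpow]
      push_cast
      ring
    simp only [star_mul', star_star, Prod.fst_mul, Prod.snd_mul, Prod.fst_star, Prod.snd_star]
    rw [hfst, norm_mul, norm_star, Real.mul_rpow (norm_nonneg _) (norm_nonneg _)]

theorem exists_kernelMajorant_mul_schurWeight_eq (hm : 0 < m) (n : ℕ) (c ε β : ℝ) (z : ℂ × ℂ)
    {v : ℂ} (hv : v ≠ 0) :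
    ∃ a : ℂ, ‖a‖ = fiberRadius ((m : ℝ) / n) z ^ m ∧
      ∀ u, kernelMajorant m n c (z * star (‖v‖ ^ ((m : ℝ) / n)⁻¹ • u, v)) *
          schurWeight ((m : ℝ) / n) ε β (‖v‖ ^ ((m : ℝ) / n)⁻¹ • u, v) =
        (‖1 - a * u ^ m‖ ^ 2)⁻¹ * (1 - ‖u‖) ^ (-ε) * (‖z.2‖ ^ (-c) *
          ((‖1 - star z.2 * v‖ ^ 2)⁻¹ * (‖v‖ ^ (-c - β) * (1 - ‖v‖) ^ (-ε)))) := by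
  obtain ⟨a, ha, hkernel⟩ := exists_kernelMajorant_mul_star_smul_mk hm n c z hv
  refine ⟨a, ha, fun u => ?_⟩
  rw [hkernel, schurWeight, fiberRadius_smul_mk _ u hv, sub_eq_add_neg (-c),
    Real.rpow_add (norm_pos_iff.mpr hv)]
  ring

theorem exists_lintegral_fiber_schurWeight_le (hm : 0 < m) (hn : 0 < n) (hε0 : 0 < ε)
    (hε1 : ε < 1) (c β : ℝ) :
    ∃ C : ℝ≥0, ∀ z ∈ domain ((m : ℝ) / n), ∀ v : ℂ, v ≠ 0 → ‖v‖ < 1 →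
      ENNReal.ofReal (‖v‖ ^ (2 / ((m : ℝ) / n))) * ∫⁻ u in ball (0 : ℂ) 1,
          ENNReal.ofReal (kernelMajorant m n c (z * star (‖v‖ ^ ((m : ℝ) / n)⁻¹ • u, v))) *
          ENNReal.ofReal (schurWeight ((m : ℝ) / n) ε β (‖v‖ ^ ((m : ℝ) / n)⁻¹ • u, v)) ≤
        C * ENNReal.ofReal ((1 - fiberRadius ((m : ℝ) / n) z) ^ (-ε) * ‖z.2‖ ^ (-c)) *
          (ENNReal.ofReal (‖1 - star z.2 * v‖ ^ 2)⁻¹ *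
            ENNReal.ofReal (‖v‖ ^ ((2 + 2 / ((m : ℝ) / n) - c - β) - 2) * (1 - ‖v‖) ^ (-ε))) := by
  set γ : ℝ := (m : ℝ) / n
  obtain ⟨C, hC⟩ := exists_lintegral_unitBall_inv_normSq_one_sub_le two_pos hε0 hε1
  refine ⟨C, fun z hz v hv hv1 => ?_⟩
  obtain ⟨a, ha, heq⟩ := exists_kernelMajorant_mul_schurWeight_eq hm n c ε β z hv
  have hr1 := fiberRadius_lt_one (by positivity) hz
  have hbound := hC hm.ne' (fiberRadius_nonneg γ z) hr1 ha
  set r := fiberRadius γ z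
  have : 0 < 1 - r := sub_pos.mpr hr1
  have hv0 : 0 < ‖v‖ := norm_pos_iff.mpr hv
  have : 0 < 1 - ‖v‖ := sub_pos.mpr hv1
  set D : ℝ := ‖z.2‖ ^ (-c) *
    ((‖1 - star z.2 * v‖ ^ 2)⁻¹ * (‖v‖ ^ (-c - β) * (1 - ‖v‖) ^ (-ε))) with hD
  have hint : ∀ u ∈ ball (0 : ℂ) 1,
      ENNReal.ofReal (kernelMajorant m n c (z * star (‖v‖ ^ γ⁻¹ • u, v))) *
          ENNReal.ofReal (schurWeight γ ε β (‖v‖ ^ γ⁻¹ • u, v)) =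
        ENNReal.ofReal (‖1 - a * u ^ m‖ ^ 2)⁻¹ *
          ENNReal.ofReal (‖u‖ ^ ((2 : ℝ) - 2) * (1 - ‖u‖) ^ (-ε)) * ENNReal.ofReal D := by
    intro u hu
    have hu' : 0 < 1 - ‖u‖ := sub_pos.mpr (mem_ball_zero_iff.mp hu)
    rw [← ENNReal.ofReal_mul (kernelMajorant_nonneg _ _ _ _), heq, sub_self, Real.rpow_zero,
      one_mul, ← ENNReal.ofReal_mul (by positivity), ← ENNReal.ofReal_mul (by positivity)]
  have hvpow : ‖v‖ ^ ((2 + 2 / γ - c - β) - 2) = ‖v‖ ^ (2 / γ) * ‖v‖ ^ (-c - β) := by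
    rw [← Real.rpow_add hv0]
    ring_nf
  calc _ = ENNReal.ofReal (‖v‖ ^ (2 / γ)) * ((∫⁻ u in ball (0 : ℂ) 1,
        ENNReal.ofReal (‖1 - a * u ^ m‖ ^ 2)⁻¹ *
          ENNReal.ofReal (‖u‖ ^ ((2 : ℝ) - 2) * (1 - ‖u‖) ^ (-ε))) * ENNReal.ofReal D) := by
        rw [setLIntegral_congr_fun isOpen_ball.measurableSet hint,
          lintegral_mul_const' _ _ ENNReal.ofReal_ne_top]
    _ ≤ ENNReal.ofReal (‖v‖ ^ (2 / γ)) *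
        (C * ENNReal.ofReal ((1 - r) ^ (-ε)) * ENNReal.ofReal D) := by gcongr
    _ = _ := by
        rw [mul_assoc, mul_left_comm, mul_assoc, ← ENNReal.ofReal_mul (by positivity),
          ← ENNReal.ofReal_mul (by positivity), ← ENNReal.ofReal_mul (by positivity),
          ← ENNReal.ofReal_mul (by positivity), hvpow, hD]
        ring_nf

theorem exists_lintegral_kernelMajorant_mul_schurWeight_le (hm : 0 < m) (hn : 0 < n)
    (hε0 : 0 < ε) (hε1 : ε < 1) (hcβ : c ≤ β) (hsum : c + β < 2 + 2 / ((m : ℝ) / n)) :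
    ∃ C : ℝ≥0, ∀ z ∈ domain ((m : ℝ) / n),
      ∫⁻ w in domain ((m : ℝ) / n), ENNReal.ofReal (kernelMajorant m n c (z * star w)) *
          ENNReal.ofReal (schurWeight ((m : ℝ) / n) ε β w) ≤
        C * ENNReal.ofReal (schurWeight ((m : ℝ) / n) ε β z) := by
  set γ : ℝ := (m : ℝ) / n
  have hγ : 0 < γ := by positivity
  obtain ⟨A, hA⟩ := exists_lintegral_fiber_schurWeight_le hm hn hε0 hε1 c β
  obtain ⟨B, hB⟩ := exists_lintegral_unitBall_inv_normSq_one_sub_le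
    (δ := 2 + 2 / γ - c - β) (by linarith) hε0 hε1
  refine ⟨A * B, fun z hz => ?_⟩
  have hr := sub_pos.mpr (fiberRadius_lt_one hγ hz)
  have hz2 := sub_pos.mpr hz.2
  have hz0 := norm_pos_iff.mpr (snd_ne_zero_of_mem_domain hz)
  rw [lintegral_domain hγ (by fun_prop)]
  calc _ ≤ ∫⁻ v in ball (0 : ℂ) 1,
        A * ENNReal.ofReal ((1 - fiberRadius γ z) ^ (-ε) * ‖z.2‖ ^ (-c)) *
          (ENNReal.ofReal (‖1 - star z.2 * v‖ ^ 2)⁻¹ *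
            ENNReal.ofReal (‖v‖ ^ ((2 + 2 / γ - c - β) - 2) * (1 - ‖v‖) ^ (-ε))) := by
        refine lintegral_mono_ae ?_
        filter_upwards [Measure.ae_ne (volume.restrict (ball (0 : ℂ) 1)) 0,
          ae_restrict_mem isOpen_ball.measurableSet] with v hv hv1
        exact hA z hz v hv (mem_ball_zero_iff.mp hv1)
    _ ≤ A * ENNReal.ofReal ((1 - fiberRadius γ z) ^ (-ε) * ‖z.2‖ ^ (-c)) *
          (B * ENNReal.ofReal ((1 - ‖z.2‖) ^ (-ε))) := by
        rw [lintegral_const_mul' _ _ (by finiteness)]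
        gcongr
        simpa only [pow_one] using hB one_ne_zero (norm_nonneg _) hz.2 (by rw [norm_star, pow_one])
    _ = A * B * ENNReal.ofReal (schurWeight γ ε c z) := by
        rw [mul_mul_mul_comm, ← ENNReal.ofReal_mul (by positivity), schurWeight]
        ring_nf
    _ ≤ _ := by
        push_cast
        unfold schurWeight
        gcongr _ * ENNReal.ofReal (_ * ?_)
        exact Real.rpow_le_rpow_of_exponent_ge hz0 hz.2.le (neg_le_neg hcβ)

end KernelMajorant

/-! ### Boundedness on `L^p` -/

section LpBound

variable {m n : ℕ} {p : ℝ≥0∞}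

theorem exists_lintegral_rpow_kernelMajorant_le (hm : 0 < m) (hn : 0 < n) {c P : ℝ} (hP : 2 ≤ P)
    (hc : 0 ≤ c) (hcP : c * P < 2 + 2 / ((m : ℝ) / n)) :
    ∃ C : ℝ≥0, ∀ F : ℂ × ℂ → ℝ≥0∞, AEMeasurable F (vol ((m : ℝ) / n)) →
      ∫⁻ z, (∫⁻ w, ENNReal.ofReal (kernelMajorant m n c (z * star w)) * F w
          ∂(vol ((m : ℝ) / n))) ^ P ∂(vol ((m : ℝ) / n)) ≤
        C * ∫⁻ z, F z ^ P ∂(vol ((m : ℝ) / n)) := by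
  set γ : ℝ := (m : ℝ) / n
  have hγ : 0 < γ := by positivity
  have := isFiniteMeasure_vol hγ
  have hpq : P.HolderConjugate P.conjExponent := .conjExponent (by linarith)
  set q := P.conjExponent
  have hP0 := hpq.pos
  have hq0 := hpq.symm.pos
  have hsum : c + c < 2 + 2 / γ := by nlinarith
  have hsum' : c + c * (P - 1) < 2 + 2 / γ := by linarith
  obtain ⟨A, hA⟩ := exists_lintegral_kernelMajorant_mul_schurWeight_le hm hn (ε := 1 / P) (β := c)
    (by positivity) ((div_lt_one hP0).mpr hpq.lt) le_rfl hsum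
  obtain ⟨B, hB⟩ := exists_lintegral_kernelMajorant_mul_schurWeight_le hm hn (c := c) (ε := 1 / q)
    (β := c * (P - 1)) (by positivity) ((div_lt_one hq0).mpr hpq.symm.lt)
    (by nlinarith) hsum'
  set h : ℂ × ℂ → ℝ≥0∞ := fun w => ENNReal.ofReal (schurWeight γ (1 / (P * q)) (c / q) w) with hh
  have hhq : ∀ w ∈ domain γ, h w ^ q = ENNReal.ofReal (schurWeight γ (1 / P) c w) := by
    intro w hw
    rw [hh, ofReal_schurWeight_rpow hγ _ _ _ hw]
    congr 2 <;> field_simp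
  have hhP : ∀ w ∈ domain γ, h w ^ P = ENNReal.ofReal (schurWeight γ (1 / q) (c * (P - 1)) w) := by
    intro w hw
    rw [hh, ofReal_schurWeight_rpow hγ _ _ _ hw, ← hpq.div_conj_eq_sub_one]
    congr 2 <;> field_simp
  have hmem : ∀ᵐ w ∂(vol γ), w ∈ domain γ := ae_restrict_mem (measurableSet_domain hγ)
  refine ⟨A ^ (P / q) * B, fun F hF => ?_⟩
  rw [ENNReal.coe_mul, ENNReal.coe_rpow_of_nonneg _ (by positivity)]
  refine lintegral_rpow_lintegral_mul_le_of_schur hpq (h := h) (k := h) (by fun_prop) (by fun_prop)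
    (by fun_prop) hF ?_ (.of_forall fun _ => ENNReal.ofReal_ne_top) ?_ ?_
  · filter_upwards [hmem] with w hw
    exact (ENNReal.ofReal_pos.mpr (schurWeight_pos hγ _ _ hw)).ne'
  · filter_upwards [hmem] with z hz
    rw [hhq z hz, vol,
      setLIntegral_congr_fun (measurableSet_domain hγ) fun w hw => by rw [hhq w hw]]
    exact hA z hz
  · filter_upwards [hmem] with w hw
    simp_rw [kernelMajorant_mul_star_comm m n c _ w]
    rw [hhP w hw, vol,
      setLIntegral_congr_fun (measurableSet_domain hγ) fun z hz => by rw [hhP z hz]]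
    exact hB w hw

theorem singularExponent_mul_toReal_lt (hm : 0 < m) (hn : 0 < n) (hP : 0 < p.toReal) :
    singularExponent m (2 * (m + n) / p.toReal) * p.toReal < 2 + 2 / ((m : ℝ) / n) := by
  have hc := singularExponent_mul_lt hm (τ := 2 * (m + n) / p.toReal) (by positivity)
  rw [lt_div_iff₀ hP] at hc
  rw [← mul_lt_mul_iff_left₀ (Nat.cast_pos.mpr hm : (0 : ℝ) < m)]
  calc _ = singularExponent m (2 * (m + n) / p.toReal) * m * p.toReal := by ring
    _ < 2 * (m + n) := hc
    _ = _ := by field_simp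

theorem exists_lintegral_rpow_subBergmanKernel_le (hm : 0 < m) (hn : 0 < n) (hp : 2 ≤ p)
    (hp' : p ≠ ∞) :
    ∃ C : ℝ≥0, ∀ F : ℂ × ℂ → ℝ≥0∞, AEMeasurable F (vol ((m : ℝ) / n)) →
      ∫⁻ z, (∫⁻ w, ‖subBergmanKernel ((m : ℝ) / n) p z w‖ₑ * F w ∂(vol ((m : ℝ) / n))) ^ p.toReal
          ∂(vol ((m : ℝ) / n)) ≤
        C * ∫⁻ z, F z ^ p.toReal ∂(vol ((m : ℝ) / n)) := by
  set γ : ℝ := (m : ℝ) / n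
  have hγ : 0 < γ := by positivity
  have hP : 2 ≤ p.toReal := by simpa using ENNReal.toReal_mono hp' hp
  obtain ⟨A, hA⟩ := exists_norm_subBergmanKernel_le hm hn hp hp'
  set c := singularExponent m (2 * (m + n) / p.toReal)
  have hcP : c * p.toReal < 2 + 2 / γ := singularExponent_mul_toReal_lt hm hn (by linarith)
  obtain ⟨B, hB⟩ := exists_lintegral_rpow_kernelMajorant_le hm hn hP (le_max_left _ _) hcP
  refine ⟨A ^ p.toReal * B, fun F hF => ?_⟩
  have hmem : ∀ᵐ w ∂(vol γ), w ∈ domain γ := ae_restrict_mem (measurableSet_domain hγ)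
  calc ∫⁻ z, (∫⁻ w, ‖subBergmanKernel γ p z w‖ₑ * F w ∂(vol γ)) ^ p.toReal ∂(vol γ)
      ≤ ∫⁻ z, (A * ∫⁻ w, ENNReal.ofReal (kernelMajorant m n c (z * star w)) * F w ∂(vol γ)) ^
          p.toReal ∂(vol γ) := by
        refine lintegral_mono_ae ?_
        filter_upwards [hmem] with z hz
        rw [← lintegral_const_mul' _ _ ENNReal.coe_ne_top]
        refine ENNReal.rpow_le_rpow ?_ (zero_le_two.trans hP)
        refine lintegral_mono_ae ?_
        filter_upwards [hmem] with w hw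
        rw [← mul_assoc, ← ENNReal.ofReal_coe_nnreal, ← ENNReal.ofReal_mul A.coe_nonneg,
          ← ofReal_norm]
        gcongr
        exact hA z hz w hw
    _ = (A : ℝ≥0∞) ^ p.toReal * ∫⁻ z, (∫⁻ w, ENNReal.ofReal (kernelMajorant m n c (z * star w)) *
          F w ∂(vol γ)) ^ p.toReal ∂(vol γ) := by
        simp_rw [ENNReal.mul_rpow_of_nonneg _ _ (zero_le_two.trans hP)]
        rw [lintegral_const_mul' _ _ (by finiteness)]
    _ ≤ (A : ℝ≥0∞) ^ p.toReal * (B * ∫⁻ z, F z ^ p.toReal ∂(vol γ)) := by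
        gcongr
        exact hB F hF
    _ = _ := by
        rw [ENNReal.coe_mul, ENNReal.coe_rpow_of_nonneg _ (zero_le_two.trans hP), mul_assoc]

theorem aestronglyMeasurable_subBergmanKernel {γ : ℝ} (hγ : 0 < γ) (hp : 2 ≤ p) :
    AEStronglyMeasurable (fun x : (ℂ × ℂ) × (ℂ × ℂ) => subBergmanKernel γ p x.1 x.2)
      ((vol γ).prod (vol γ)) := by
  refine aestronglyMeasurable_of_tendsto_ae Filter.atTop
    (f := fun (s : Finset (allowable γ p)) x => ∑ α ∈ s, kernelTerm γ x.1 x.2 α)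
    (fun s => Measurable.aestronglyMeasurable ?_) ?_
  · unfold kernelTerm
    fun_prop
  · rw [vol, Measure.prod_restrict, ← Measure.volume_eq_prod]
    filter_upwards [ae_restrict_mem ((measurableSet_domain hγ).prod (measurableSet_domain hγ))]
      with x hx
    exact (summable_kernelTerm hγ hp hx.1 hx.2).hasSum

theorem isBoundedOnLp_of_norm_le (hm : 0 < m) (hn : 0 < n) (hp : 2 ≤ p) (hp' : p ≠ ∞)
    {L : ℂ × ℂ → ℂ × ℂ → ℂ} (hL : ∀ z w, ‖L z w‖ ≤ ‖subBergmanKernel ((m : ℝ) / n) p z w‖)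
    (hLm : AEStronglyMeasurable (fun x : (ℂ × ℂ) × (ℂ × ℂ) => L x.1 x.2)
      ((vol ((m : ℝ) / n)).prod (vol ((m : ℝ) / n))))
    (hLz : ∀ z ∈ domain ((m : ℝ) / n), AEStronglyMeasurable (L z) (vol ((m : ℝ) / n))) :
    IsBoundedOnLp ((m : ℝ) / n) p L := by
  set γ : ℝ := (m : ℝ) / n
  have hγ : 0 < γ := by positivity
  have := isFiniteMeasure_vol hγ
  have hp0 : p ≠ 0 := (two_pos.trans_le hp).ne'
  have hP : 0 < p.toReal := ENNReal.toReal_pos hp0 hp'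
  obtain ⟨C, hC⟩ := exists_lintegral_rpow_subBergmanKernel_le hm hn hp hp'
  refine ⟨C ^ (1 / p.toReal), fun f hf => ?_⟩
  have hle : eLpNorm (integralOp γ L f) p (vol γ) ≤
      (C ^ (1 / p.toReal) : ℝ≥0) * eLpNorm f p (vol γ) := by
    rw [eLpNorm_eq_lintegral_rpow_enorm_toReal hp0 hp',
      eLpNorm_eq_lintegral_rpow_enorm_toReal hp0 hp',
      ENNReal.coe_rpow_of_nonneg _ (by positivity),
      ← ENNReal.mul_rpow_of_nonneg _ _ (by positivity)]
    gcongr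
    refine (lintegral_mono fun z => ?_).trans (hC _ hf.1.enorm)
    gcongr
    refine (enorm_integral_le_lintegral_enorm _).trans (lintegral_mono fun w => ?_)
    rw [enorm_mul]
    gcongr
    exact enorm_le_iff_norm_le.mpr (hL z w)
  refine ⟨fun z hz => ?_, ⟨(hLm.mul hf.1.comp_snd).integral_prod_right',
    hle.trans_lt (ENNReal.mul_lt_top ENNReal.coe_lt_top hf.2)⟩, hle⟩
  refine Integrable.mono (integrableOn_subBergmanKernel_mul hγ hp (hf.mono_exponent hp) hz)
    ((hLz z hz).mul hf.1) (.of_forall fun w => ?_)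
  rw [norm_mul, norm_mul]
  gcongr
  exact hL z w

theorem aestronglyMeasurable_subBergmanKernel_right {γ : ℝ} (hγ : 0 < γ) (hp : 2 ≤ p) {z : ℂ × ℂ}
    (hz : z ∈ domain γ) : AEStronglyMeasurable (subBergmanKernel γ p z) (vol γ) := by
  have := isFiniteMeasure_vol hγ
  have h := (integrableOn_subBergmanKernel_mul hγ hp (memLp_const 1) hz).aestronglyMeasurable
  simp only [mul_one] at h
  exact h

theorem isBoundedOnLp_subBergmanKernel (hm : 0 < m) (hn : 0 < n) (hp : 2 ≤ p) (hp' : p ≠ ∞) :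
    IsBoundedOnLp ((m : ℝ) / n) p (subBergmanKernel ((m : ℝ) / n) p) :=
  isBoundedOnLp_of_norm_le hm hn hp hp' (fun _ _ => le_rfl)
    (aestronglyMeasurable_subBergmanKernel (by positivity) hp)
    fun _ hz => aestronglyMeasurable_subBergmanKernel_right (by positivity) hp hz

theorem isBoundedOnLp_absKernel_subBergmanKernel (hm : 0 < m) (hn : 0 < n) (hp : 2 ≤ p)
    (hp' : p ≠ ∞) :
    IsBoundedOnLp ((m : ℝ) / n) p (absKernel (subBergmanKernel ((m : ℝ) / n) p)) :=
  isBoundedOnLp_of_norm_le hm hn hp hp' (fun _ _ => by simp [absKernel])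
    (Complex.continuous_ofReal.comp_aestronglyMeasurable
      (aestronglyMeasurable_subBergmanKernel (by positivity) hp).norm)
    fun _ hz => Complex.continuous_ofReal.comp_aestronglyMeasurable
      (aestronglyMeasurable_subBergmanKernel_right (by positivity) hp hz).norm

theorem memBergman_integralOp (hm : 0 < m) (hn : 0 < n) (hp : 2 ≤ p) (hp' : p ≠ ∞)
    {f : ℂ × ℂ → ℂ} (hf : MemLp f p (vol ((m : ℝ) / n))) :
    MemBergman ((m : ℝ) / n) p
      (integralOp ((m : ℝ) / n) (subBergmanKernel ((m : ℝ) / n) p) f) := by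
  have := isFiniteMeasure_vol (γ := (m : ℝ) / n) (by positivity)
  obtain ⟨C, hC⟩ := isBoundedOnLp_subBergmanKernel hm hn hp hp'
  exact ⟨differentiableOn_integralOp (by positivity) hp (hf.mono_exponent hp), (hC f hf).2.1⟩

end LpBound

end GenHartogs

end

theorem theoremT (m n : ℕ) (hm : 0 < m) (hn : 0 < n) (hmn : Nat.Coprime m n)
    (p : ℝ≥0∞) (hp : 2 ≤ p) (hp_fin : p ≠ ∞)
    (γ : ℝ) (hγ : γ = (m : ℝ) / (n : ℝ))
    (K : ℂ × ℂ → ℂ × ℂ → ℂ) (hK : K = GenHartogs.subBergmanKernel γ p) :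
    -- the Bergman kernel is the full series over the `L^2`-allowable multi-indices
    (IsClosed (GenHartogs.bergmanSubspace γ 2 : Set (GenHartogs.L2 γ)) ∧
      GenHartogs.IsRepresentingKernel γ (GenHartogs.subBergmanKernel γ 2)
        (GenHartogs.subBergmanProjection γ 2) ∧
      GenHartogs.allowable γ p ⊆ GenHartogs.allowable γ 2 ∧
      ∀ z ∈ GenHartogs.domain γ, ∀ w ∈ GenHartogs.domain γ,
        Summable (fun α : GenHartogs.allowable γ 2 => GenHartogs.kernelTerm γ z w α)) ∧
    -- the sub-Bergman projection has the subseries `K` as its kernel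
    GenHartogs.IsRepresentingKernel γ K (GenHartogs.subBergmanProjection γ p) ∧
    -- the absolute-value operator is bounded on `L^p`
    GenHartogs.IsBoundedOnLp γ p (GenHartogs.absKernel K) ∧
    -- the sub-Bergman projection maps `L^p` boundedly into `A^p`
    GenHartogs.IsBoundedOnLp γ p K ∧
    (∀ f : ℂ × ℂ → ℂ, MemLp f p (GenHartogs.vol γ) →
      GenHartogs.MemBergman γ p (GenHartogs.integralOp γ K f)) ∧
    -- it reproduces `A^p`
    (∀ h : ℂ × ℂ → ℂ, GenHartogs.MemBergman γ p h →
      ∀ z ∈ GenHartogs.domain γ, GenHartogs.integralOp γ K h z = h z) ∧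
    -- it gives the unique `L^2`-nearest element of `A^p`
    (∀ g : ℂ × ℂ → ℂ, MemLp g p (GenHartogs.vol γ) →
      ∀ h : ℂ × ℂ → ℂ, GenHartogs.MemBergman γ p h →
        eLpNorm (g - GenHartogs.integralOp γ K g) 2 (GenHartogs.vol γ)
            ≤ eLpNorm (g - h) 2 (GenHartogs.vol γ) ∧
        (eLpNorm (g - h) 2 (GenHartogs.vol γ)
            = eLpNorm (g - GenHartogs.integralOp γ K g) 2 (GenHartogs.vol γ) →
          Set.EqOn h (GenHartogs.integralOp γ K g) (GenHartogs.domain γ))) := by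
  subst hγ hK
  have hγ : (0 : ℝ) < (m : ℝ) / n := by positivity
  have := GenHartogs.isFiniteMeasure_vol hγ
  exact ⟨⟨GenHartogs.isClosed_bergmanSubspace hγ,
      GenHartogs.isRepresentingKernel_subBergmanKernel hγ le_rfl (by simp),
      GenHartogs.allowable_subset_two hγ hp,
      fun z hz w hw => GenHartogs.summable_kernelTerm hγ le_rfl hz hw⟩,
    GenHartogs.isRepresentingKernel_subBergmanKernel hγ hp hp_fin,
    GenHartogs.isBoundedOnLp_absKernel_subBergmanKernel hm hn hp hp_fin,
    GenHartogs.isBoundedOnLp_subBergmanKernel hm hn hp hp_fin,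
    fun f hf => GenHartogs.memBergman_integralOp hm hn hp hp_fin hf,
    fun h hh => GenHartogs.integralOp_eq_self hγ hp hp_fin hh,
    fun g hg h hh =>
      ⟨GenHartogs.eLpNorm_sub_integralOp_le hγ hp hp_fin (hg.mono_exponent hp) hh,
        GenHartogs.eqOn_integralOp_of_eLpNorm_sub_eq hγ hp hp_fin (hg.mono_exponent hp) hh⟩⟩
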